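/- Let $\partial=\sum_{i\ge0}u_{i+1}\,\partial/\partial u_i$ on $\mathbb{Q}[u_0,u_1,u_2,\dots]$, and let the polynomials $m_d\in\mathbb{Q}[u_0,u_1,\dots]$, $d\ge0$, be defined by requiring that the series $$b(\lambda)=1+\sum_{d\ge0}\frac{(2d+1)!!\,m_d}{\lambda^{d+1}}$$ satisfies $$b\,\partial^2(b)-\tfrac12\,\partial(b)^2-2(\lambda-2u_0)\,b^2=-2\lambda$$ (so $m_0=u_0$, $m_1=\frac12u_0^2+\frac1{12}u_2$, etc.). For each $d\ge1$, the $d$-th member of the normalized Painlevé XXXIV hierarchy $$2^{2d+1}(2d+1)!!\;\partial_X\Bigl(m_d\bigl(\tfrac{Y}{2},\tfrac{Y_X}{2},\tfrac{Y_{XX}}{2},\dots\bigr)\Bigr)-X\,Y_X-2Y=0$$ has a unique formal solution of the form $$Y(X)=\sum_{n\ge0}\frac{y_{d,n}}{X^{(2d+1)n+2}},\qquad y_{d,n}\in\mathbb{C},\quad y_{d,0}=\frac14,$$ and its coefficients satisfy $$y_{d,n}\;\sim\;\frac1\pi\,\frac{((2d+1)n+1)!}{(2d+1)^n\,n!}\qquad(n\to\infty).$$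 -/

import Mathlib

open Filter Asymptotics
open scoped Nat

noncomputable section

namespace PainleveXXXIV

/-- The ring `ℚ[u₀, u₁, u₂, …]` of differential polynomials. -/
abbrev DiffPoly : Type := MvPolynomial ℕ ℚ

/-- The derivation `∂ = ∑ uᵢ₊₁ ∂/∂uᵢ`. -/
def del : Derivation ℚ DiffPoly DiffPoly :=
  MvPolynomial.mkDerivation ℚ fun i => MvPolynomial.X (i + 1)

/-- `∂` applied coefficientwise to a power series in `λ⁻¹`. -/
def delSeries (b : PowerSeries DiffPoly) : PowerSeries DiffPoly :=
  PowerSeries.mk fun k => del (PowerSeries.coeff k b)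

/-- The variable `PowerSeries.X` stands for `λ⁻¹`. The series `b = 1 + O(λ⁻¹)` satisfies
`b ∂²b - (1/2) (∂b)² - 2 (λ - 2u₀) b² = -2λ`; the equation is written after multiplication by
`λ⁻¹`, which makes it an identity of power series in `λ⁻¹`. -/
def IsResolvent (b : PowerSeries DiffPoly) : Prop :=
  PowerSeries.constantCoeff b = 1 ∧
    PowerSeries.X * (b * delSeries (delSeries b)) -
        (1 / 2 : ℚ) • (PowerSeries.X * delSeries b ^ 2) -
        2 * (1 - 2 * (PowerSeries.C (MvPolynomial.X 0) * PowerSeries.X)) * b ^ 2 = -2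

/-- The part of the coefficient of `λ⁻ᵏ⁻¹` in the equation of `IsResolvent` that only involves the
coefficients `β 0, …, β k`, divided by `4`. -/
def resolventStep (k : ℕ) (β : ℕ → DiffPoly) : DiffPoly :=
  (1 / 4 : ℚ) •
    (∑ p ∈ Finset.HasAntidiagonal.antidiagonal k,
        (β p.1 * del (del (β p.2)) - (1 / 2 : ℚ) • (del (β p.1) * del (β p.2)) +
          4 * MvPolynomial.X 0 * (β p.1 * β p.2)) -
      2 * ∑ i ∈ Finset.range k, β (i + 1) * β (k - i))

theorem resolventStep_congr (k : ℕ) (β γ : ℕ → DiffPoly) (h : ∀ i ≤ k, β i = γ i) :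
    resolventStep k β = resolventStep k γ := by
  unfold resolventStep
  congr 2
  · refine Finset.sum_congr rfl fun p hp => ?_
    have hp' := Finset.HasAntidiagonal.mem_antidiagonal.1 hp
    rw [h p.1 (by omega), h p.2 (by omega)]
  · congr 1
    refine Finset.sum_congr rfl fun i hi => ?_
    have hi' := Finset.mem_range.1 hi
    rw [h (i + 1) (by omega), h (k - i) (by omega)]

theorem isResolvent_iff (b : PowerSeries DiffPoly) :
    IsResolvent b ↔ PowerSeries.coeff 0 b = 1 ∧
      ∀ k, PowerSeries.coeff (k + 1) b = resolventStep k fun i => PowerSeries.coeff i b := by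
  unfold IsResolvent
  rw [← PowerSeries.coeff_zero_eq_constantCoeff_apply]
  refine and_congr_right fun h0 => ?_
  have key : ∀ k, PowerSeries.coeff (k + 1)
      (PowerSeries.X * (b * delSeries (delSeries b)) -
        (1 / 2 : ℚ) • (PowerSeries.X * delSeries b ^ 2) -
        2 * (1 - 2 * (PowerSeries.C (MvPolynomial.X 0) * PowerSeries.X)) * b ^ 2) =
      4 * resolventStep k (fun i => PowerSeries.coeff i b) - 4 * PowerSeries.coeff (k + 1) b := by
    intro k
    have e1 : (2 * (1 - 2 * (PowerSeries.C (MvPolynomial.X 0) * PowerSeries.X)) * b ^ 2 :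
        PowerSeries DiffPoly) = PowerSeries.C 2 * (b * b) -
          PowerSeries.C (4 * MvPolynomial.X 0) * (PowerSeries.X * (b * b)) := by
      have : (PowerSeries.C (2 : DiffPoly) : PowerSeries DiffPoly) = 2 := map_ofNat _ 2
      have h4 : (PowerSeries.C (4 : DiffPoly) : PowerSeries DiffPoly) = 4 := map_ofNat _ 4
      rw [map_mul, this, h4]; ring
    have e2 : PowerSeries.coeff (k + 1) (b * b) = 2 * PowerSeries.coeff (k + 1) b +
        ∑ i ∈ Finset.range k, PowerSeries.coeff (i + 1) b * PowerSeries.coeff (k - i) b := by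
      rw [PowerSeries.coeff_mul, Finset.Nat.sum_antidiagonal_eq_sum_range_succ
        (fun i j => PowerSeries.coeff i b * PowerSeries.coeff j b), Finset.sum_range_succ,
        Finset.sum_range_succ']
      simp only [Nat.add_sub_add_right, Nat.sub_zero, Nat.sub_self, h0]
      ring
    have e3 : (4 : DiffPoly) = MvPolynomial.C 4 := (map_ofNat _ 4).symm
    have e4 : ∀ x : DiffPoly, 4 * ((1 / 4 : ℚ) • x) = x := by
      intro x
      rw [e3, MvPolynomial.C_mul', smul_smul]; norm_num
    rw [e1, resolventStep, e4]
    simp only [map_sub, PowerSeries.coeff_C_mul, PowerSeries.coeff_smul, e2, pow_two,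
      PowerSeries.coeff_succ_X_mul, PowerSeries.coeff_mul k, delSeries, PowerSeries.coeff_mk,
      Finset.sum_add_distrib, Finset.sum_sub_distrib, ← Finset.mul_sum, Finset.smul_sum]
    ring
  have h4 : (4 : DiffPoly) ≠ 0 := by norm_num
  have hc : ∀ k, PowerSeries.coeff (k + 1) (-2 : PowerSeries DiffPoly) = 0 := by
    intro k
    have : (-2 : PowerSeries DiffPoly) = PowerSeries.C (-2) := by
      rw [map_neg, map_ofNat]
    rw [this, PowerSeries.coeff_C]; simp
  constructor
  · intro h k
    have := key k
    rw [h, hc, ← mul_sub] at this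
    have := (mul_eq_zero.1 this.symm).resolve_left h4
    exact (sub_eq_zero.1 this).symm
  · intro h
    ext1 n
    cases n with
    | zero =>
      simp [PowerSeries.coeff_zero_eq_constantCoeff_apply,
        ← PowerSeries.coeff_zero_eq_constantCoeff_apply b, h0]
    | succ k => rw [key k, hc, ← h k, sub_self]

/-- The coefficients of the resolvent series, by recursion. -/
def resolventCoeff : ℕ → DiffPoly
  | 0 => 1
  | k + 1 => resolventStep k fun i => if _h : i ≤ k then resolventCoeff i else 0

theorem existsUnique_isResolvent : ∃! b, IsResolvent b := by
  refine ⟨PowerSeries.mk resolventCoeff, (isResolvent_iff _).2 ⟨?_, fun k => ?_⟩, ?_⟩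
  · rw [PowerSeries.coeff_mk, resolventCoeff]
  · rw [PowerSeries.coeff_mk, resolventCoeff]
    refine resolventStep_congr _ _ _ fun i hi => ?_
    simp [hi]
  · intro b hb
    obtain ⟨h0, h⟩ := (isResolvent_iff b).1 hb
    ext1 n
    rw [PowerSeries.coeff_mk]
    induction n using Nat.strong_induction_on with
    | _ n ih =>
      cases n with
      | zero => rw [h0, resolventCoeff]
      | succ k =>
        rw [h k, resolventCoeff]
        refine resolventStep_congr _ _ _ fun i hi => ?_
        simp [hi, ih i (by omega)]

/-- The series `b(λ)`. -/
def resolvent : PowerSeries DiffPoly := existsUnique_isResolvent.choose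

theorem isResolvent_resolvent : IsResolvent resolvent := existsUnique_isResolvent.choose_spec.1

/-- The polynomials `m_d`, where `b(λ) = 1 + ∑ (2d+1)!! m_d / λ^(d+1)`. -/
def m (d : ℕ) : DiffPoly := (1 / ((2 * d + 1)‼ : ℚ)) • PowerSeries.coeff (d + 1) resolvent

/-- Formal Laurent series in `w = X⁻¹` over `ℂ`: the coefficient at `k` is that of `X^(-k)`. -/
abbrev InvSeries : Type := LaurentSeries ℂ

/-- The independent variable `X = w⁻¹`. -/
def varX : InvSeries := HahnSeries.single (-1) 1

/-- The derivation `d/dX = -w² d/dw`. -/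
def dX (f : InvSeries) : InvSeries :=
  -(HahnSeries.single 2 1 * LaurentSeries.derivative ℂ f)

/-- The left-hand side of the `d`-th member of the hierarchy,
`2^(2d+1) (2d+1)!! ∂_X (m_d(Y/2, Y_X/2, Y_XX/2, …)) - X Y_X - 2 Y`. -/
def P34 (d : ℕ) (Y : InvSeries) : InvSeries :=
  (2 ^ (2 * d + 1) * ((2 * d + 1)‼ : ℂ)) •
      dX (MvPolynomial.aeval (fun i => (1 / 2 : ℂ) • dX^[i] Y) (m d)) -
    varX * dX Y - (2 : ℂ) • Y

/-- The series `∑ yₙ X^(-(2d+1)n-2)`. -/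
def ansatz (d : ℕ) (y : ℕ → ℂ) : InvSeries :=
  HahnSeries.ofPowerSeries ℤ ℂ (PowerSeries.mk fun k =>
    if 2 ≤ k ∧ (2 * d + 1) ∣ k - 2 then y ((k - 2) / (2 * d + 1)) else 0)

/-- `y` is the coefficient sequence of a formal solution `∑ yₙ X^(-(2d+1)n-2)`, `y₀ = 1/4`, of the
`d`-th member of the hierarchy. -/
def IsFormalSolution (d : ℕ) (y : ℕ → ℂ) : Prop :=
  y 0 = 1 / 4 ∧ P34 d (ansatz d y) = 0

end PainleveXXXIV

end

open Filter Asymptotics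
open scoped Nat

noncomputable section

namespace PainleveXXXIV

/-! The formal solution is a self-similar KdV solution. Let `β_k` be the coefficient of `λ⁻ᵏ` in
`b`, and let `flow k` be the derivation commuting with `∂` that sends `u₀` to `∂ β_{k+1}`; these
flows commute. The potential `1 / (8 (1 - x)²)`, the initial value of the Brézin–Gross–Witten
solution, is homogeneous. Its evolution under the `d`-th flow is therefore, up to a power of `1 -
x`, a series in `t_d / (1 - x)^(2d+1)`. With `X = x - 1` and a suitable value of the time,
homogeneity turns the flow equation into the `d`-th equation of the hierarchy
(`isFormalSolution_sol`). Uniqueness is order by order (`isFormalSolution_unique`). Hence the `n`-th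
coefficient is an explicit multiple of `psi (replicate n d)`, the `n`-th `t_d`-derivative at the
base point of the free energy `F` with `∂² F = u₀` (`sol_eq`).

These derivatives obey Virasoro constraints. The generating series of the `x`-derivatives of the
Virasoro expressions is built from `b`, `db/dλ` and the current `∑ (2k+1) t_k λᵏ + ∑ F_k λ⁻ᵏ⁻¹`, and
the third-order Lenard operator sends it to a single monomial (`lenard_loopSeries`). So each
constraint implies the next, up to integrations in `x` that homogeneity makes unambiguous. The
outcome is the cut-and-join recursion `psi_succ_cons`.

After normalization (`cnum`), the weights of the linear terms of the recursion add up to the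
coefficient on its left-hand side. Each number is thus a weighted average of numbers of smaller
weight, plus a quadratic error of order `1 / N²` at weight `N`. These errors are summable, which
gives the uniform bound `cnum_le_four`. When the recursion is applied to the smallest part, merging
two parts outweighs cutting one, so repeated averaging leads to one-part multisets with a large part
(`abs_cnum_sub_le`). One-part numbers are explicit, and by Wallis' product they tend to `2 / π`;
half of this is the constant `1 / π`. -/

/-! ### Derivations acting coefficientwise on power series -/

section SeriesDeriv

variable {R : Type*} [CommRing R] [Algebra ℚ R]

/-- The coefficientwise extension of a derivation to power series. -/
def seriesDeriv (D : Derivation ℚ R R) : Derivation ℚ (PowerSeries R) (PowerSeries R) :=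
  Derivation.mk'
    { toFun := fun f => PowerSeries.mk fun n => D (PowerSeries.coeff n f)
      map_add' := fun f g => by ext n; simp
      map_smul' := fun c f => by ext n; simp }
    fun f g => by
      ext n
      simp only [LinearMap.coe_mk, AddHom.coe_mk, PowerSeries.coeff_mk, PowerSeries.coeff_mul,
        map_sum, Derivation.leibniz, map_add, smul_eq_mul, Finset.sum_add_distrib]
      congr 1
      rw [← Finset.Nat.sum_antidiagonal_swap]
      rfl

@[simp]
theorem coeff_seriesDeriv (D : Derivation ℚ R R) (f : PowerSeries R) (n : ℕ) :
    PowerSeries.coeff n (seriesDeriv D f) = D (PowerSeries.coeff n f) :=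
  PowerSeries.coeff_mk n fun n => D (PowerSeries.coeff n f)

@[simp]
theorem seriesDeriv_X (D : Derivation ℚ R R) : seriesDeriv D PowerSeries.X = 0 := by
  ext n
  rw [coeff_seriesDeriv, PowerSeries.coeff_X]
  split_ifs <;> simp

@[simp]
theorem seriesDeriv_C (D : Derivation ℚ R R) (a : R) :
    seriesDeriv D (PowerSeries.C a) = PowerSeries.C (D a) := by
  ext n
  rw [coeff_seriesDeriv, PowerSeries.coeff_C, PowerSeries.coeff_C]
  split_ifs <;> simp

@[simp]
theorem seriesDeriv_X_pow (D : Derivation ℚ R R) (k : ℕ) :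
    seriesDeriv D (PowerSeries.X ^ k) = 0 := by
  simp [Derivation.leibniz_pow]

theorem seriesDeriv_X_pow_mul (D : Derivation ℚ R R) (k : ℕ) (f : PowerSeries R) :
    seriesDeriv D (PowerSeries.X ^ k * f) = PowerSeries.X ^ k * seriesDeriv D f := by
  simp [Derivation.leibniz]

theorem seriesDeriv_X_mul (D : Derivation ℚ R R) (f : PowerSeries R) :
    seriesDeriv D (PowerSeries.X * f) = PowerSeries.X * seriesDeriv D f := by
  simp [Derivation.leibniz]

theorem seriesDeriv_derivative (D : Derivation ℚ R R) (f : PowerSeries R) :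
    seriesDeriv D (PowerSeries.derivative R f) = PowerSeries.derivative R (seriesDeriv D f) := by
  ext n
  simp [PowerSeries.coeff_derivative, Derivation.leibniz, mul_comm]

theorem derivation_two {B : Type*} [CommRing B] [Algebra ℚ B] (D : Derivation ℚ B B) : D 2 = 0 :=
  D.map_natCast 2

theorem derivation_four {B : Type*} [CommRing B] [Algebra ℚ B] (D : Derivation ℚ B B) : D 4 = 0 :=
  D.map_natCast 4

end SeriesDeriv

/-! ### Algebraic identities for the resolvent equation -/

section Identities

variable {B : Type*} [CommRing B] [Algebra ℚ B] (D : Derivation ℚ B B) (z v b : B)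

/-- The operator `z D³ - 4 (1 - 2 v z) D + 4 z D(v)` that annihilates resolvents. -/
def lenard (f : B) : B :=
  z * D (D (D f)) - 4 * (1 - 2 * v * z) * D f + 4 * z * D v * f

/-- The linearization at `b` of the quadratic resolvent equation. -/
def linearization (h : B) : B :=
  z * (h * D (D b) + b * D (D h) - D b * D h) - 4 * (1 - 2 * v * z) * (b * h)

variable {D z v b}

/-- Differentiating the quadratic equation makes the products `D b * D (D b)` cancel, and `2 * b`
factors out of the rest. -/
theorem mul_lenard_eq_zero (hz : D z = 0)
    (hb : 2 * (z * (b * D (D b))) - z * D b ^ 2 - 4 * (1 - 2 * v * z) * b ^ 2 = -4) :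
    2 * b * lenard D z v b = 0 := by
  have h := congrArg D hb
  simp only [map_sub, map_neg, Derivation.leibniz, Derivation.leibniz_pow, hz,
    derivation_two, derivation_four, smul_eq_mul, nsmul_eq_mul, Derivation.map_one_eq_zero] at h
  rw [lenard]
  push_cast at h
  linear_combination h

/-- The effect on the linearized equation of a Wronskian with a second, inhomogeneous solution. -/
theorem linearization_wronskian {g r : B} (hb : lenard D z v b = 0) (hg : lenard D z v g = r) :
    linearization D z v b (g * D b - b * D g) = - (b ^ 2 * r) := by
  rw [lenard] at hb hg
  simp only [linearization, map_sub, map_add, Derivation.leibniz, smul_eq_mul]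
  linear_combination (b * g) * hb - b ^ 2 * hg

/-- Apply `δ` to the quadratic equation: the variation of `b` solves the linearized equation, with a
source coming from the variation of the potential `v`. -/
theorem linearization_derivation (δ : Derivation ℚ B B) (hcomm : ∀ f, δ (D f) = D (δ f))
    (hz : δ z = 0)
    (hb : 2 * (z * (b * D (D b))) - z * D b ^ 2 - 4 * (1 - 2 * v * z) * b ^ 2 = -4) :
    2 * linearization D z v b (δ b) = -8 * (z * δ v * b ^ 2) := by
  have h := congrArg δ hb
  simp only [map_sub, map_neg, Derivation.leibniz, Derivation.leibniz_pow, hz,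
    derivation_two, derivation_four, smul_eq_mul, nsmul_eq_mul, Derivation.map_one_eq_zero, hcomm] at h
  rw [linearization]
  push_cast at h
  linear_combination h

/-- The Virasoro generating function, differentiated once, is annihilated by `lenard` up to the
explicit term on the right. -/
theorem lenard_loop {f s q : B} (hz : D z = 0) (hq : D q = 0)
    (hb : 2 * (z * (b * D (D b))) - z * D b ^ 2 - 4 * (1 - 2 * v * z) * b ^ 2 = -4)
    (hlb : lenard D z v b = 0) (hlf : lenard D z v f = 4 * z * D b) (hs : D s = q * b) :
    lenard D z v (q * (f * D b - b * D f) + 2 * (b * s)) = -8 * q := by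
  rw [lenard] at hlb hlf ⊢
  have h := congrArg D hlf
  have h' := congrArg D hlb
  simp only [map_sub, map_add, map_zero, Derivation.leibniz, hz, hq,
    derivation_two, derivation_four, smul_eq_mul, hs, Derivation.map_one_eq_zero] at h h' ⊢
  -- The right-hand side `-8 * q` is `2 * q` times the constant `-4` of the quadratic equation; all
  -- other terms are multiples of the linear equations and their derivatives.
  linear_combination (q * f) * h' - q * b * h +
    (2 * s + 2 * q * D f) * hlb - 2 * q * D b * hlf + 2 * q * hb

end Identities

/-! ### The resolvent and the commuting flows -/

/-- The coefficient of `λ⁻ᵏ` in the resolvent. -/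
def beta (k : ℕ) : DiffPoly := PowerSeries.coeff k resolvent

theorem beta_zero : beta 0 = 1 := ((isResolvent_iff _).1 isResolvent_resolvent).1

theorem beta_succ (k : ℕ) : beta (k + 1) = resolventStep k beta :=
  ((isResolvent_iff _).1 isResolvent_resolvent).2 k

@[simp]
theorem del_X (i : ℕ) : del (MvPolynomial.X i) = MvPolynomial.X (i + 1) :=
  MvPolynomial.mkDerivation_X _ _ _

theorem beta_one : beta 1 = MvPolynomial.X 0 := by
  rw [beta_succ, resolventStep]
  simp only [Finset.HasAntidiagonal.antidiagonal_zero, Finset.sum_singleton, beta_zero,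
    Derivation.map_one_eq_zero, map_zero, Finset.sum_range_zero]
  have : (4 : DiffPoly) = MvPolynomial.C 4 := (map_ofNat _ 4).symm
  simp only [mul_zero, smul_zero, sub_zero, zero_add, mul_one, this, MvPolynomial.C_mul', smul_smul]
  norm_num

theorem resolvent_equation :
    2 * (PowerSeries.X * (resolvent * seriesDeriv del (seriesDeriv del resolvent))) -
      PowerSeries.X * seriesDeriv del resolvent ^ 2 -
      4 * (1 - 2 * PowerSeries.C (MvPolynomial.X 0) * PowerSeries.X) * resolvent ^ 2 = -4 := by
  have h := isResolvent_resolvent.2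
  have h2 : ∀ f : PowerSeries DiffPoly, 2 * ((1 / 2 : ℚ) • f) = f := by
    intro f
    rw [two_mul, ← add_smul]
    norm_num
  have e : delSeries = seriesDeriv del := rfl
  rw [e] at h
  linear_combination 2 * h + h2 (PowerSeries.X * seriesDeriv del resolvent ^ 2)

theorem two_ne_zero_series : (2 : PowerSeries DiffPoly) ≠ 0 := by
  intro h
  have := congrArg PowerSeries.constantCoeff h
  rw [map_ofNat, map_zero] at this
  exact two_ne_zero this

theorem resolvent_ne_zero : resolvent ≠ 0 := by
  intro h
  have := beta_zero
  rw [beta, h, map_zero] at this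
  exact zero_ne_one this

/-- The third-order linear equation for the resolvent. -/
theorem lenard_resolvent :
    lenard (seriesDeriv del) PowerSeries.X (PowerSeries.C (MvPolynomial.X 0)) resolvent = 0 := by
  have h := mul_lenard_eq_zero (seriesDeriv_X del) resolvent_equation
  simpa [resolvent_ne_zero, two_ne_zero_series] using h

/-! ### Lenard recursion -/

section LenardCoeff

variable {R : Type*} [CommRing R] [Algebra ℚ R] (D : Derivation ℚ R R) (a : R) (f : PowerSeries R)

theorem coeff_succ_lenard (n : ℕ) :
    PowerSeries.coeff (n + 1) (lenard (seriesDeriv D) PowerSeries.X (PowerSeries.C a) f) =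
      D (D (D (PowerSeries.coeff n f))) + 8 * a * D (PowerSeries.coeff n f) +
        4 * D a * PowerSeries.coeff n f - 4 * D (PowerSeries.coeff (n + 1) f) := by
  have e : lenard (seriesDeriv D) PowerSeries.X (PowerSeries.C a) f =
      PowerSeries.X * (seriesDeriv D (seriesDeriv D (seriesDeriv D f)) +
        PowerSeries.C (8 * a) * seriesDeriv D f + PowerSeries.C (4 * D a) * f) -
      PowerSeries.C 4 * seriesDeriv D f := by
    simp only [lenard, seriesDeriv_C, map_mul, map_ofNat]
    ring
  rw [e, map_sub, PowerSeries.coeff_succ_X_mul]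
  simp only [map_add, PowerSeries.coeff_C_mul, coeff_seriesDeriv]

theorem coeff_zero_lenard :
    PowerSeries.coeff 0 (lenard (seriesDeriv D) PowerSeries.X (PowerSeries.C a) f) =
      - 4 * D (PowerSeries.coeff 0 f) := by
  have e : lenard (seriesDeriv D) PowerSeries.X (PowerSeries.C a) f =
      PowerSeries.X * (seriesDeriv D (seriesDeriv D (seriesDeriv D f)) +
        PowerSeries.C (8 * a) * seriesDeriv D f + PowerSeries.C (4 * D a) * f) -
      PowerSeries.C 4 * seriesDeriv D f := by
    simp only [lenard, seriesDeriv_C, map_mul, map_ofNat]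
    ring
  rw [e, map_sub, PowerSeries.coeff_zero_X_mul]
  simp only [PowerSeries.coeff_C_mul, coeff_seriesDeriv]
  ring

end LenardCoeff

/-- The coefficient of `λ⁻ⁿ⁻¹` in the third-order linear equation. -/
theorem del_beta_succ (n : ℕ) :
    4 * del (beta (n + 1)) = del (del (del (beta n))) + 8 * MvPolynomial.X 0 * del (beta n) +
      4 * MvPolynomial.X 1 * beta n := by
  have h := coeff_succ_lenard del (MvPolynomial.X 0) resolvent n
  rw [lenard_resolvent, map_zero, del_X] at h
  simp only [beta]
  linear_combination h

/-- The polynomial part of `λᵏ b(λ)`, multiplied by `λ⁻ᵏ`. -/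
def truncResolvent (k : ℕ) : PowerSeries DiffPoly :=
  PowerSeries.mk fun i => if i ≤ k then beta i else 0

/-- Truncation breaks the Lenard recursion at exactly one place, where the missing `β_{k+1}` leaves
a defect. This defect is the source produced by the `k`-th flow. -/
theorem lenard_truncResolvent (k : ℕ) :
    lenard (seriesDeriv del) PowerSeries.X (PowerSeries.C (MvPolynomial.X 0)) (truncResolvent k) =
      4 * PowerSeries.C (del (beta (k + 1))) * PowerSeries.X ^ (k + 1) := by
  have hr : (4 * PowerSeries.C (del (beta (k + 1))) * PowerSeries.X ^ (k + 1) :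
      PowerSeries DiffPoly) = PowerSeries.C (4 * del (beta (k + 1))) * PowerSeries.X ^ (k + 1) := by
    rw [map_mul, map_ofNat]
  rw [hr]
  ext1 n
  rw [PowerSeries.coeff_C_mul, PowerSeries.coeff_X_pow]
  cases n with
  | zero => simp [coeff_zero_lenard, truncResolvent, beta_zero]
  | succ n =>
    rw [coeff_succ_lenard, del_X]
    simp only [truncResolvent, PowerSeries.coeff_mk]
    rcases lt_trichotomy n k with h | h | h
    · rw [if_pos h.le, if_pos (by omega), if_neg (by omega), del_beta_succ]
      ring
    · subst h
      rw [if_pos le_rfl, if_neg (by omega), if_pos rfl, del_beta_succ]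
      simp
    · rw [if_neg (by omega), if_neg (by omega), if_neg (by omega)]
      simp

/-- The `k`-th flow: the derivation commuting with `∂` that sends `u₀` to `∂ β_{k+1}`. -/
def flow (k : ℕ) : Derivation ℚ DiffPoly DiffPoly :=
  MvPolynomial.mkDerivation ℚ fun i => del^[i] (del (beta (k + 1)))

@[simp]
theorem flow_X (k i : ℕ) : flow k (MvPolynomial.X i) = del^[i] (del (beta (k + 1))) :=
  MvPolynomial.mkDerivation_X _ _ _

/-- Since `β₁ = u₀`, the zeroth time is the space variable `x`. -/
theorem flow_zero : flow 0 = del := by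
  refine MvPolynomial.derivation_ext fun i => ?_
  rw [flow_X, del_X, zero_add, beta_one, del_X]
  induction i with
  | zero => rfl
  | succ i ih => rw [Function.iterate_succ_apply', ih, del_X]

theorem flow_del (k : ℕ) (a : DiffPoly) : flow k (del a) = del (flow k a) := by
  have h : ⁅flow k, del⁆ = 0 := by
    refine MvPolynomial.derivation_ext fun i => ?_
    rw [Derivation.commutator_apply, del_X, flow_X, flow_X, Function.iterate_succ_apply']
    simp
  have := congrArg (fun D : Derivation ℚ DiffPoly DiffPoly => D a) h
  simpa [Derivation.commutator_apply, sub_eq_zero] using this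

theorem seriesDeriv_flow_del (k : ℕ) (f : PowerSeries DiffPoly) :
    seriesDeriv (flow k) (seriesDeriv del f) = seriesDeriv del (seriesDeriv (flow k) f) := by
  ext1 n
  simp [flow_del]

/-- At order zero in `λ⁻¹` the linearization is multiplication by `-4`, so `h` is divisible by
`λ⁻¹`; the operator commutes with this factor, and the argument repeats. -/
theorem eq_zero_of_linearization_eq_zero (h : PowerSeries DiffPoly)
    (hh : linearization (seriesDeriv del) PowerSeries.X (PowerSeries.C (MvPolynomial.X 0))
      resolvent h = 0) : h = 0 := by
  have key : ∀ n : ℕ, ∀ h : PowerSeries DiffPoly,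
      linearization (seriesDeriv del) PowerSeries.X (PowerSeries.C (MvPolynomial.X 0))
        resolvent h = 0 → PowerSeries.X ^ n ∣ h := by
    intro n
    induction n with
    | zero => intro h _; simp
    | succ n ih =>
      intro h hh
      have h0 : PowerSeries.constantCoeff h = 0 := by
        have := congrArg PowerSeries.constantCoeff hh
        have e : PowerSeries.constantCoeff resolvent = 1 := isResolvent_resolvent.1
        simpa [linearization, e, map_ofNat PowerSeries.constantCoeff 4] using this
      obtain ⟨q, rfl⟩ := PowerSeries.X_dvd_iff.2 h0
      have hq : PowerSeries.X * linearization (seriesDeriv del) PowerSeries.X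
          (PowerSeries.C (MvPolynomial.X 0)) resolvent q = 0 := by
        rw [← hh]
        simp only [linearization, seriesDeriv_X_mul]
        ring
      rw [pow_succ']
      exact mul_dvd_mul_left _ (ih q ((mul_eq_zero.1 hq).resolve_left PowerSeries.X_ne_zero))
  ext1 n
  exact PowerSeries.X_pow_dvd_iff.1 (key (n + 1) h hh) n (Nat.lt_succ_self n)

/-- Both sides solve the linearized resolvent equation with the same source, by
`linearization_derivation` and `linearization_wronskian`, and the linearization is injective. -/
theorem flow_resolvent (k : ℕ) :
    PowerSeries.X ^ k * seriesDeriv (flow k) resolvent =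
      truncResolvent k * seriesDeriv del resolvent -
        resolvent * seriesDeriv del (truncResolvent k) := by
  rw [← sub_eq_zero]
  refine eq_zero_of_linearization_eq_zero _ ?_
  have h1 := linearization_wronskian lenard_resolvent (lenard_truncResolvent k)
  have h2 := linearization_derivation (seriesDeriv (flow k)) (seriesDeriv_flow_del k)
    (seriesDeriv_X _) resolvent_equation
  have h3 : linearization (seriesDeriv del) PowerSeries.X (PowerSeries.C (MvPolynomial.X 0))
      resolvent (PowerSeries.X ^ k * seriesDeriv (flow k) resolvent) =
      PowerSeries.X ^ k * linearization (seriesDeriv del) PowerSeries.X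
        (PowerSeries.C (MvPolynomial.X 0)) resolvent (seriesDeriv (flow k) resolvent) := by
    simp only [linearization, seriesDeriv_X_pow_mul]
    ring
  have h4 : ∀ f g : PowerSeries DiffPoly, linearization (seriesDeriv del) PowerSeries.X
      (PowerSeries.C (MvPolynomial.X 0)) resolvent (f - g) =
      linearization (seriesDeriv del) PowerSeries.X (PowerSeries.C (MvPolynomial.X 0)) resolvent f -
      linearization (seriesDeriv del) PowerSeries.X (PowerSeries.C (MvPolynomial.X 0))
        resolvent g := by
    intro f g
    simp only [linearization, map_sub]
    ring
  rw [seriesDeriv_C, flow_X, Function.iterate_zero_apply] at h2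
  refine (mul_eq_zero.1 ?_).resolve_left two_ne_zero_series
  rw [h4, h3, h1]
  linear_combination PowerSeries.X ^ k * h2

/-- The Wronskian of two coefficients of the resolvent. -/
def wronskian (p : ℕ × ℕ) : DiffPoly := beta p.1 * del (beta p.2) - beta p.2 * del (beta p.1)

theorem wronskian_swap (p : ℕ × ℕ) : wronskian p.swap = - wronskian p := by
  simp [wronskian]

theorem flow_beta (k l : ℕ) :
    flow k (beta l) = ∑ p ∈ Finset.HasAntidiagonal.antidiagonal (k + l),
      if p.1 ≤ k then wronskian p else 0 := by
  have h := congrArg (PowerSeries.coeff (k + l)) (flow_resolvent k)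
  rw [add_comm k l, PowerSeries.coeff_X_pow_mul, coeff_seriesDeriv, mul_comm resolvent, map_sub,
    PowerSeries.coeff_mul, PowerSeries.coeff_mul, ← Finset.sum_sub_distrib] at h
  rw [beta, h, add_comm l k]
  refine Finset.sum_congr rfl fun p _ => ?_
  simp only [coeff_seriesDeriv, truncResolvent, PowerSeries.coeff_mk, wronskian]
  split_ifs
  · simp only [beta]; ring
  · simp

theorem sum_wronskian (n : ℕ) :
    ∑ p ∈ Finset.HasAntidiagonal.antidiagonal n, wronskian p = 0 := by
  have h : ∑ p ∈ Finset.HasAntidiagonal.antidiagonal n, wronskian p =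
      - ∑ p ∈ Finset.HasAntidiagonal.antidiagonal n, wronskian p := by
    conv_lhs => rw [← Finset.Nat.sum_antidiagonal_swap]
    simp [wronskian_swap]
  exact self_eq_neg.1 h

/-- For `i + j = k + l + 1`, the condition `i ≤ k` fails exactly when `j ≤ l`. By antisymmetry the
difference of the two truncated sums is therefore the full sum. -/
theorem sum_antidiagonal_le_of_swap (k l : ℕ) (w : ℕ × ℕ → DiffPoly)
    (hw : ∀ p, w p.swap = - w p)
    (h0 : ∑ p ∈ Finset.HasAntidiagonal.antidiagonal (k + l + 1), w p = 0) :
    ∑ p ∈ Finset.HasAntidiagonal.antidiagonal (k + l + 1), (if p.1 ≤ k then w p else 0) =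
      ∑ p ∈ Finset.HasAntidiagonal.antidiagonal (k + l + 1), (if p.1 ≤ l then w p else 0) := by
  conv_rhs => rw [← Finset.Nat.sum_antidiagonal_swap]
  rw [← sub_eq_zero, ← Finset.sum_sub_distrib]
  refine (Finset.sum_congr rfl fun p hp => ?_).trans h0
  have := Finset.HasAntidiagonal.mem_antidiagonal.1 hp
  rw [hw, Prod.fst_swap]
  by_cases h : p.1 ≤ k
  · rw [if_pos h, if_neg (by omega)]; simp
  · rw [if_neg h, if_pos (by omega)]; simp

/-- Commutativity of the flows reduces to this symmetry, because `flow k (flow l u₀)` is `∂` of the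
left-hand side. -/
theorem flow_beta_symm (k l : ℕ) : flow k (beta (l + 1)) = flow l (beta (k + 1)) := by
  have h := sum_antidiagonal_le_of_swap k l wronskian wronskian_swap (sum_wronskian _)
  rw [flow_beta k (l + 1), flow_beta l (k + 1), show k + (l + 1) = k + l + 1 by ring,
    show l + (k + 1) = k + l + 1 by ring]
  exact h

theorem flow_iterate_del (k i : ℕ) (a : DiffPoly) : flow k (del^[i] a) = del^[i] (flow k a) := by
  induction i generalizing a with
  | zero => rfl
  | succ i ih => rw [Function.iterate_succ_apply, ih, flow_del, ← Function.iterate_succ_apply]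

theorem flow_flow_X (k l i : ℕ) :
    flow k (flow l (MvPolynomial.X i)) = flow l (flow k (MvPolynomial.X i)) := by
  rw [flow_X, flow_X, flow_iterate_del, flow_iterate_del, flow_del, flow_del, flow_beta_symm]

theorem flow_comm (k l : ℕ) (a : DiffPoly) : flow k (flow l a) = flow l (flow k a) := by
  have h : ⁅flow k, flow l⁆ = 0 := by
    refine MvPolynomial.derivation_ext fun i => ?_
    rw [Derivation.commutator_apply, Derivation.zero_apply, sub_eq_zero]
    exact flow_flow_X k l i
  have := congrArg (fun D : Derivation ℚ DiffPoly DiffPoly => D a) h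
  simpa [Derivation.commutator_apply, sub_eq_zero] using this

/-- In the sum of the formulas `flow_beta`, the Wronskian of `(i, j)` is counted once for each `k`
with `i ≤ k ≤ n`, that is `j + 1` times. The factor turns the sum into a coefficient of the
Wronskian of `b` with `db/dλ`. -/
theorem sum_flow_beta (n : ℕ) :
    ∑ p ∈ Finset.HasAntidiagonal.antidiagonal n, flow p.1 (beta p.2) =
      ∑ p ∈ Finset.HasAntidiagonal.antidiagonal n,
        (p.1 : DiffPoly) * (beta p.2 * del (beta p.1) - beta p.1 * del (beta p.2)) := by
  have h1 : ∑ p ∈ Finset.HasAntidiagonal.antidiagonal n, flow p.1 (beta p.2) =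
      ∑ q ∈ Finset.HasAntidiagonal.antidiagonal n, ((q.2 : DiffPoly) + 1) * wronskian q := by
    have : ∀ p ∈ Finset.HasAntidiagonal.antidiagonal n, flow p.1 (beta p.2) =
        ∑ q ∈ Finset.HasAntidiagonal.antidiagonal n, if q.1 ≤ p.1 then wronskian q else 0 := by
      intro p hp
      rw [flow_beta, Finset.HasAntidiagonal.mem_antidiagonal.1 hp]
    rw [Finset.sum_congr rfl this, Finset.sum_comm]
    refine Finset.sum_congr rfl fun q hq => ?_
    have hq := Finset.HasAntidiagonal.mem_antidiagonal.1 hq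
    rw [← Finset.sum_filter, Finset.sum_const, nsmul_eq_mul]
    congr 1
    have : ((Finset.HasAntidiagonal.antidiagonal n).filter fun p : ℕ × ℕ => q.1 ≤ p.1).card =
        q.2 + 1 := by
      have e : (Finset.HasAntidiagonal.antidiagonal n).filter (fun p : ℕ × ℕ => q.1 ≤ p.1) =
          (Finset.range (q.2 + 1)).image fun i => (n - i, i) := by
        ext ⟨a, b⟩
        simp only [Finset.mem_filter, Finset.HasAntidiagonal.mem_antidiagonal, Finset.mem_image,
          Finset.mem_range, Prod.mk.injEq]
        constructor
        · rintro ⟨h, h'⟩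
          exact ⟨b, by omega, by omega, rfl⟩
        · rintro ⟨i, hi, rfl, rfl⟩
          omega
      rw [e, Finset.card_image_of_injective _ fun i j h => (Prod.mk.inj h).2, Finset.card_range]
    rw [this]
    push_cast
    ring
  simp only [add_mul, one_mul] at h1
  rw [h1, Finset.sum_add_distrib, sum_wronskian, add_zero, ← Finset.Nat.sum_antidiagonal_swap]
  refine Finset.sum_congr rfl fun p _ => ?_
  rw [wronskian_swap, wronskian, Prod.snd_swap]
  ring

/-! ### Weights and evaluation at `u = 1 / (8 (1 - x)²)` -/

/-- The derivation that multiplies a weighted homogeneous polynomial by its weight. -/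
def weightDeriv : Derivation ℚ DiffPoly DiffPoly :=
  MvPolynomial.mkDerivation ℚ fun i => (i + 2 : ℚ) • MvPolynomial.X i

@[simp]
theorem weightDeriv_X (i : ℕ) :
    weightDeriv (MvPolynomial.X i) = (i + 2 : ℚ) • MvPolynomial.X i :=
  MvPolynomial.mkDerivation_X _ _ _

theorem weightDeriv_del (a : DiffPoly) : weightDeriv (del a) = del (weightDeriv a) + del a := by
  have h : ⁅weightDeriv, del⁆ = del := by
    refine MvPolynomial.derivation_ext fun i => ?_
    rw [Derivation.commutator_apply, del_X, weightDeriv_X, weightDeriv_X, Derivation.map_smul, del_X,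
      ← sub_smul]
    push_cast
    ring_nf
    simp
  have := congrArg (fun D : Derivation ℚ DiffPoly DiffPoly => D a) h
  simp only [Derivation.commutator_apply] at this
  exact (eq_add_of_sub_eq' this)

/-- `a` is weighted homogeneous of weight `w`, where `uᵢ` has weight `i + 2`. -/
def HasWeight (a : DiffPoly) (w : ℚ) : Prop := weightDeriv a = w • a

theorem HasWeight.mul {a b : DiffPoly} {v w : ℚ} (ha : HasWeight a v) (hb : HasWeight b w) :
    HasWeight (a * b) (v + w) := by
  unfold HasWeight at *
  rw [Derivation.leibniz, ha, hb, smul_eq_mul, smul_eq_mul, mul_smul_comm, mul_smul_comm,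
    mul_comm b a, ← add_smul, add_comm]

theorem HasWeight.add {a b : DiffPoly} {w : ℚ} (ha : HasWeight a w) (hb : HasWeight b w) :
    HasWeight (a + b) w := by
  unfold HasWeight at *
  rw [map_add, ha, hb, smul_add]

theorem HasWeight.smul {a : DiffPoly} {w : ℚ} (c : ℚ) (ha : HasWeight a w) :
    HasWeight (c • a) w := by
  unfold HasWeight at *
  rw [Derivation.map_smul, ha, smul_comm]

theorem HasWeight.sub {a b : DiffPoly} {w : ℚ} (ha : HasWeight a w) (hb : HasWeight b w) :
    HasWeight (a - b) w := by
  unfold HasWeight at *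
  rw [map_sub, ha, hb, smul_sub]

theorem HasWeight.sum {ι : Type*} {s : Finset ι} {a : ι → DiffPoly} {w : ℚ}
    (h : ∀ i ∈ s, HasWeight (a i) w) : HasWeight (∑ i ∈ s, a i) w := by
  unfold HasWeight at *
  rw [map_sum, Finset.smul_sum, Finset.sum_congr rfl h]

theorem HasWeight.del {a : DiffPoly} {w : ℚ} (ha : HasWeight a w) :
    HasWeight (del a) (w + 1) := by
  unfold HasWeight at *
  rw [weightDeriv_del, ha, Derivation.map_smul, add_smul, one_smul]

theorem hasWeight_X (i : ℕ) : HasWeight (MvPolynomial.X i) (i + 2) := weightDeriv_X i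

theorem hasWeight_beta (k : ℕ) : HasWeight (beta k) (2 * k) := by
  induction k using Nat.strong_induction_on with
  | _ k ih =>
    cases k with
    | zero => simp [HasWeight, beta_zero]
    | succ k =>
      rw [beta_succ, resolventStep]
      have e4 : ∀ x : DiffPoly, 4 * x = (4 : ℚ) • x := fun x => by
        rw [← MvPolynomial.C_mul', map_ofNat]
      have e2 : ∀ x : DiffPoly, 2 * x = (2 : ℚ) • x := fun x => by
        rw [← MvPolynomial.C_mul', map_ofNat]
      rw [e2]
      refine HasWeight.smul _ (HasWeight.sub (HasWeight.sum fun p hp => ?_)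
        (HasWeight.smul _ (HasWeight.sum fun i hi => ?_)))
      · have hp := Finset.HasAntidiagonal.mem_antidiagonal.1 hp
        have h1 := ih p.1 (by omega)
        have h2 := ih p.2 (by omega)
        have hc : (p.1 : ℚ) + p.2 = k := by exact_mod_cast hp
        refine HasWeight.add (HasWeight.sub ?_ (HasWeight.smul _ ?_)) ?_
        · convert h1.mul h2.del.del using 1
          push_cast; linarith
        · convert h1.del.mul h2.del using 1
          push_cast; linarith
        · rw [mul_assoc, e4]
          refine HasWeight.smul _ ?_
          convert (hasWeight_X 0).mul (h1.mul h2) using 1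
          push_cast; linarith
      · have hi := Finset.mem_range.1 hi
        convert (ih (i + 1) (by omega)).mul (ih (k - i) (by omega)) using 1
        rw [Nat.cast_sub hi.le]
        push_cast; ring

theorem weightDeriv_flow (k : ℕ) (a : DiffPoly) :
    weightDeriv (flow k a) = flow k (weightDeriv a) + (2 * k + 1 : ℚ) • flow k a := by
  have h : ⁅weightDeriv, flow k⁆ = (2 * k + 1 : ℚ) • flow k := by
    refine MvPolynomial.derivation_ext fun i => ?_
    rw [Derivation.commutator_apply, flow_X, weightDeriv_X, Derivation.map_smul, flow_X]
    have : ∀ i : ℕ, HasWeight (PainleveXXXIV.del^[i] (PainleveXXXIV.del (beta (k + 1))))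
        (2 * k + 3 + i) := by
      intro i
      induction i with
      | zero =>
        rw [Function.iterate_zero_apply]
        convert (hasWeight_beta (k + 1)).del using 1
        push_cast
        ring
      | succ i ih =>
        rw [Function.iterate_succ_apply']
        convert ih.del using 1
        push_cast; ring
    rw [this i, ← sub_smul, Derivation.smul_apply, flow_X]
    congr 1
    ring
  have := congrArg (fun D : Derivation ℚ DiffPoly DiffPoly => D a) h
  simp only [Derivation.commutator_apply, Derivation.smul_apply] at this
  exact (eq_add_of_sub_eq' this)

theorem HasWeight.flow {a : DiffPoly} {w : ℚ} (k : ℕ) (ha : HasWeight a w) :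
    HasWeight (flow k a) (w + (2 * k + 1)) := by
  unfold HasWeight at *
  rw [weightDeriv_flow, ha, Derivation.map_smul, ← add_smul]

/-- Evaluation at the function `1 / (8 (1 - x)²)` and `x = 0`. -/
def evalBase : DiffPoly →ₐ[ℚ] ℚ := MvPolynomial.aeval fun i => ((i + 1)! : ℚ) / 8

/-- On the base function a polynomial of weight `w` equals a constant times `(1 - x)^(-w)`, whose
derivative at `x = 0` is `w` times its value. -/
theorem evalBase_del (a : DiffPoly) : evalBase (del a) = evalBase (weightDeriv a) := by
  induction a using MvPolynomial.induction_on with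
  | C c => simp
  | add p q hp hq => simp [hp, hq]
  | mul_X p i hp =>
    simp only [Derivation.leibniz, map_add, smul_eq_mul, map_mul, hp, del_X, weightDeriv_X,
      map_smul]
    simp only [evalBase, MvPolynomial.aeval_X, Nat.factorial_succ (i + 1)]
    push_cast
    ring

theorem evalBase_del_of_hasWeight {a : DiffPoly} {w : ℚ} (ha : HasWeight a w) :
    evalBase (del a) = w * evalBase a := by
  rw [evalBase_del, ha, map_smul, smul_eq_mul]

/-- Homogeneity makes the Lenard recursion scalar: with `w = 2k` its right-hand side has the factor
`w (w + 1) (w + 2) + w + 1 = (w + 1)³`. -/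
theorem evalBase_beta_succ (k : ℕ) :
    evalBase (beta (k + 1)) = (2 * k + 1) ^ 3 / (8 * (k + 1)) * evalBase (beta k) := by
  have h := congrArg evalBase (del_beta_succ k)
  have h1 := hasWeight_beta k
  have h2 := hasWeight_beta (k + 1)
  simp only [map_mul, map_add, map_ofNat, evalBase_del_of_hasWeight h1,
    evalBase_del_of_hasWeight h2, evalBase_del_of_hasWeight h1.del,
    evalBase_del_of_hasWeight h1.del.del] at h
  have e0 : evalBase (MvPolynomial.X 0) = 1 / 8 := by simp [evalBase]
  have e1 : evalBase (MvPolynomial.X 1) = 2 / 8 := by simp [evalBase]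
  rw [e0, e1] at h
  push_cast at h
  have hk : (k + 1 : ℚ) ≠ 0 := by positivity
  field_simp
  linear_combination h

/-! ### Iterated commuting derivations indexed by multisets -/

section IterDeriv

variable {A : Type*} [CommRing A] [Algebra ℚ A] {D : ℕ → Derivation ℚ A A}
  (hD : ∀ k l a, D k (D l a) = D l (D k a))

/-- The composite of the commuting derivations `D k`, `k ∈ S`. -/
def iterDeriv (hD : ∀ k l a, D k (D l a) = D l (D k a)) (S : Multiset ℕ) (a : A) : A :=
  haveI : LeftCommutative fun (k : ℕ) (a : A) => D k a := ⟨hD⟩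
  S.foldr (fun k a => D k a) a

@[simp]
theorem iterDeriv_zero (a : A) : iterDeriv hD 0 a = a := rfl

@[simp]
theorem iterDeriv_cons (k : ℕ) (S : Multiset ℕ) (a : A) :
    iterDeriv hD (k ::ₘ S) a = D k (iterDeriv hD S a) :=
  haveI : LeftCommutative fun (k : ℕ) (a : A) => D k a := ⟨hD⟩
  Multiset.foldr_cons (fun (k : ℕ) (a : A) => D k a) a k S

theorem iterDeriv_apply (k : ℕ) (S : Multiset ℕ) (a : A) :
    iterDeriv hD S (D k a) = D k (iterDeriv hD S a) := by
  induction S using Multiset.induction_on with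
  | empty => rfl
  | cons l S ih => rw [iterDeriv_cons, iterDeriv_cons, ih, hD]

theorem iterDeriv_add (S : Multiset ℕ) (a b : A) :
    iterDeriv hD S (a + b) = iterDeriv hD S a + iterDeriv hD S b := by
  induction S using Multiset.induction_on with
  | empty => rfl
  | cons l S ih => simp only [iterDeriv_cons, ih, map_add]

theorem iterDeriv_map_zero (S : Multiset ℕ) : iterDeriv hD S (0 : A) = 0 := by
  induction S using Multiset.induction_on with
  | empty => rfl
  | cons l S ih => simp only [iterDeriv_cons, ih, map_zero]

theorem iterDeriv_sum {ι : Type*} (S : Multiset ℕ) (s : Finset ι) (f : ι → A) :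
    iterDeriv hD S (∑ i ∈ s, f i) = ∑ i ∈ s, iterDeriv hD S (f i) := by
  induction S using Multiset.induction_on with
  | empty => rfl
  | cons l S ih => simp only [iterDeriv_cons, ih, map_sum]

theorem iterDeriv_two_mul (S : Multiset ℕ) (a : A) :
    iterDeriv hD S (2 * a) = 2 * iterDeriv hD S a := by
  rw [two_mul, iterDeriv_add, two_mul]

theorem iterDeriv_sub (S : Multiset ℕ) (a b : A) :
    iterDeriv hD S (a - b) = iterDeriv hD S a - iterDeriv hD S b := by
  rw [eq_sub_iff_add_eq, ← iterDeriv_add, sub_add_cancel]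

theorem iterDeriv_mul (S : Multiset ℕ) (a b : A) :
    iterDeriv hD S (a * b) =
      (S.antidiagonal.map fun p => iterDeriv hD p.1 a * iterDeriv hD p.2 b).sum := by
  induction S using Multiset.induction_on with
  | empty => simp
  | cons l S ih =>
    rw [iterDeriv_cons, ih, map_multiset_sum, Multiset.map_map, Multiset.antidiagonal_cons,
      Multiset.map_add, Multiset.sum_add, Multiset.map_map, Multiset.map_map,
      ← Multiset.sum_map_add]
    refine congrArg Multiset.sum (Multiset.map_congr rfl fun p _ => ?_)
    simp only [Function.comp_apply, Derivation.leibniz, smul_eq_mul, Prod.map_fst, Prod.map_snd,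
      iterDeriv_cons, id]
    ring

end IterDeriv

/-! ### The numbers attached to multisets -/

/-- The weight `∑ (2d + 1)` of a multiset. -/
def mwt (S : Multiset ℕ) : ℕ := (S.map fun d => 2 * d + 1).sum

@[simp]
theorem mwt_zero : mwt 0 = 0 := rfl

@[simp]
theorem mwt_cons (k : ℕ) (S : Multiset ℕ) : mwt (k ::ₘ S) = 2 * k + 1 + mwt S := by
  simp [mwt]

/-- The composite of the flows indexed by `S`. -/
abbrev flows (S : Multiset ℕ) (a : DiffPoly) : DiffPoly := iterDeriv flow_comm S a

theorem HasWeight.flows {a : DiffPoly} {w : ℚ} (S : Multiset ℕ) (ha : HasWeight a w) :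
    HasWeight (flows S a) (w + mwt S) := by
  induction S using Multiset.induction_on with
  | empty => simpa using ha
  | cons l S ih =>
    rw [PainleveXXXIV.flows, iterDeriv_cons]
    convert ih.flow l using 1
    rw [mwt_cons]; push_cast; ring

/-- The number attached to the nonempty multiset `S`: the value at the base point of the derivative
along the flows in `S` of a double integral of `u₀`. -/
def psi (S : Multiset ℕ) : ℚ :=
  evalBase (flows S (MvPolynomial.X 0)) / (mwt S * (mwt S + 1))

theorem flow_X_zero (k : ℕ) : flow k (MvPolynomial.X 0) = del (beta (k + 1)) := flow_X k 0

/-- This expresses `∂ F_k = β_{k+1}`: the flows `0` and `k` send `u₀` to `∂² β_{k+1}`, and the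
denominator of `psi` undoes the two `∂`. -/
theorem psi_zero_cons_cons (k : ℕ) (S : Multiset ℕ) :
    psi (0 ::ₘ k ::ₘ S) = evalBase (flows S (beta (k + 1))) := by
  have hw : HasWeight (flows S (beta (k + 1))) (2 * k + 2 + mwt S) := by
    convert (hasWeight_beta (k + 1)).flows S using 1
    push_cast; ring
  have e : flows (0 ::ₘ k ::ₘ S) (MvPolynomial.X 0) = del (del (flows S (beta (k + 1)))) := by
    simp only [flows, iterDeriv_cons]
    rw [← iterDeriv_apply flow_comm k, flow_X_zero, ← flow_zero, iterDeriv_apply]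
  rw [psi, e, evalBase_del_of_hasWeight hw.del, evalBase_del_of_hasWeight hw, mwt_cons, mwt_cons]
  push_cast
  have h1 : (2 * (k : ℚ) + 2 + mwt S) ≠ 0 := by positivity
  have h2 : (2 * (k : ℚ) + 2 + mwt S + 1) ≠ 0 := by positivity
  rw [div_eq_iff]
  · ring
  · intro h
    rcases mul_eq_zero.1 h with h | h
    · exact h1 (by linarith)
    · exact h2 (by linarith)

/-- The dilaton equation. It fails for empty `S`: there `psi` has the default value `0` of a
division by zero, while `psi {0} = 1 / 8`. -/
theorem psi_zero_cons (S : Multiset ℕ) (hS : S ≠ 0) : psi (0 ::ₘ S) = mwt S * psi S := by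
  have hw : HasWeight (flows S (MvPolynomial.X 0)) (2 + mwt S) := by
    convert (hasWeight_X 0).flows S using 1
    push_cast; ring
  rw [psi, psi, flows, iterDeriv_cons, flow_zero, evalBase_del_of_hasWeight hw, mwt_cons]
  obtain ⟨k, hk⟩ := Multiset.exists_mem_of_ne_zero hS
  obtain ⟨R, rfl⟩ := Multiset.exists_cons_of_mem hk
  rw [mwt_cons]
  push_cast
  field_simp
  ring

theorem psi_singleton (k : ℕ) : psi {k} = evalBase (beta (k + 1)) / (2 * k + 1) := by
  have h := psi_zero_cons_cons k 0
  rw [psi_zero_cons _ Multiset.cons_ne_zero, flows, iterDeriv_zero] at h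
  rw [← h, mwt_cons, mwt_zero, eq_div_iff (by positivity)]
  push_cast
  rw [mul_comm]
  simp

/-! ### The extended ring with times and free energy variables -/

/-- Variables of the extended ring: the jets `uᵢ`, the times `tₖ`, and the derivatives along `S` of
the `k`-th first derivative of the free energy. -/
inductive Var
  | u (i : ℕ)
  | t (k : ℕ)
  | g (k : ℕ) (S : Multiset ℕ)

/-- The extended ring. -/
abbrev ExtPoly : Type := MvPolynomial Var ℚ

/-- The inclusion of differential polynomials into the extended ring. -/
def incl : DiffPoly →ₐ[ℚ] ExtPoly := MvPolynomial.rename Var.u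

/-- The time variable. -/
def tv (k : ℕ) : ExtPoly := MvPolynomial.X (Var.t k)

/-- The free energy variable. -/
def gv (k : ℕ) (S : Multiset ℕ) : ExtPoly := MvPolynomial.X (Var.g k S)

/-- The flows on the extended ring. -/
def extFlow (k : ℕ) : Derivation ℚ ExtPoly ExtPoly :=
  MvPolynomial.mkDerivation ℚ fun v => match v with
    | Var.u i => incl (flow k (MvPolynomial.X i))
    | Var.t j => if j = k then 1 else 0
    | Var.g j S => gv j (k ::ₘ S)

/-- The weight derivation on the extended ring. -/
def extWeight : Derivation ℚ ExtPoly ExtPoly :=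
  MvPolynomial.mkDerivation ℚ fun v => match v with
    | Var.u i => (i + 2 : ℚ) • MvPolynomial.X (Var.u i)
    | Var.t j => (-(2 * j + 1) : ℚ) • tv j
    | Var.g j S => (2 * j + 1 + mwt S : ℚ) • gv j S

/-- Evaluation of the extended ring at the base point. -/
def extEval : ExtPoly →ₐ[ℚ] ℚ :=
  MvPolynomial.aeval fun v => match v with
    | Var.u i => ((i + 1)! : ℚ) / 8
    | Var.t j => if j = 0 then -1 else 0
    | Var.g j S => psi (j ::ₘ S)

theorem incl_X (i : ℕ) : incl (MvPolynomial.X i) = MvPolynomial.X (Var.u i) :=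
  MvPolynomial.rename_X _ _

theorem extFlow_u (k i : ℕ) :
    extFlow k (MvPolynomial.X (Var.u i)) = incl (flow k (MvPolynomial.X i)) :=
  MvPolynomial.mkDerivation_X _ _ _

theorem extFlow_tv (k j : ℕ) : extFlow k (tv j) = if j = k then 1 else 0 :=
  MvPolynomial.mkDerivation_X _ _ _

theorem extFlow_gv (k j : ℕ) (S : Multiset ℕ) : extFlow k (gv j S) = gv j (k ::ₘ S) :=
  MvPolynomial.mkDerivation_X _ _ _

theorem extWeight_u (i : ℕ) :
    extWeight (MvPolynomial.X (Var.u i)) = (i + 2 : ℚ) • MvPolynomial.X (Var.u i) :=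
  MvPolynomial.mkDerivation_X _ _ _

theorem extWeight_tv (j : ℕ) : extWeight (tv j) = (-(2 * j + 1) : ℚ) • tv j :=
  MvPolynomial.mkDerivation_X _ _ _

theorem extWeight_gv (j : ℕ) (S : Multiset ℕ) :
    extWeight (gv j S) = (2 * j + 1 + mwt S : ℚ) • gv j S :=
  MvPolynomial.mkDerivation_X _ _ _

theorem extEval_u (i : ℕ) : extEval (MvPolynomial.X (Var.u i)) = ((i + 1)! : ℚ) / 8 :=
  MvPolynomial.aeval_X _ _

theorem extEval_tv (j : ℕ) : extEval (tv j) = if j = 0 then -1 else 0 :=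
  MvPolynomial.aeval_X _ _

theorem extEval_gv (j : ℕ) (S : Multiset ℕ) : extEval (gv j S) = psi (j ::ₘ S) :=
  MvPolynomial.aeval_X _ _

theorem incl_intertwine {D : Derivation ℚ DiffPoly DiffPoly} {E : Derivation ℚ ExtPoly ExtPoly}
    (h : ∀ i, E (MvPolynomial.X (Var.u i)) = incl (D (MvPolynomial.X i))) (a : DiffPoly) :
    E (incl a) = incl (D a) := by
  induction a using MvPolynomial.induction_on with
  | C c =>
    rw [MvPolynomial.derivation_C, map_zero, incl, MvPolynomial.rename_C,
      MvPolynomial.derivation_C]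
  | add p q hp hq => rw [map_add, map_add, hp, hq, map_add, map_add]
  | mul_X p i hp =>
    rw [map_mul, Derivation.leibniz, Derivation.leibniz, incl_X, h, hp, map_add, smul_eq_mul,
      smul_eq_mul, smul_eq_mul, smul_eq_mul, map_mul, map_mul, incl_X]

theorem extFlow_incl (k : ℕ) (a : DiffPoly) : extFlow k (incl a) = incl (flow k a) :=
  incl_intertwine (extFlow_u k) a

theorem extWeight_incl (a : DiffPoly) : extWeight (incl a) = incl (weightDeriv a) :=
  incl_intertwine (fun i => by rw [extWeight_u, weightDeriv_X, map_smul, incl_X]) a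

theorem extEval_incl (a : DiffPoly) : extEval (incl a) = evalBase a := by
  have h : extEval.comp incl = evalBase := by
    refine MvPolynomial.algHom_ext fun i => ?_
    rw [AlgHom.comp_apply, incl_X, extEval_u, evalBase, MvPolynomial.aeval_X]
  rw [← h]; rfl

theorem extFlow_comm (k l : ℕ) (a : ExtPoly) :
    extFlow k (extFlow l a) = extFlow l (extFlow k a) := by
  have h : ⁅extFlow k, extFlow l⁆ = 0 := by
    refine MvPolynomial.derivation_ext fun v => ?_
    rw [Derivation.commutator_apply, Derivation.zero_apply, sub_eq_zero]
    rcases v with i | j | ⟨j, S⟩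
    · rw [extFlow_u, extFlow_u, extFlow_incl, extFlow_incl, flow_comm]
    · change extFlow k (extFlow l (tv j)) = extFlow l (extFlow k (tv j))
      rw [extFlow_tv, extFlow_tv]
      split_ifs <;> simp
    · change extFlow k (extFlow l (gv j S)) = extFlow l (extFlow k (gv j S))
      rw [extFlow_gv, extFlow_gv, extFlow_gv, extFlow_gv, Multiset.cons_swap]
  have := congrArg (fun D : Derivation ℚ ExtPoly ExtPoly => D a) h
  rwa [Derivation.commutator_apply, Derivation.zero_apply, sub_eq_zero] at this

theorem extWeight_extFlow (k : ℕ) (a : ExtPoly) :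
    extWeight (extFlow k a) = extFlow k (extWeight a) + (2 * k + 1 : ℚ) • extFlow k a := by
  have h : ⁅extWeight, extFlow k⁆ = (2 * k + 1 : ℚ) • extFlow k := by
    refine MvPolynomial.derivation_ext fun v => ?_
    rw [Derivation.commutator_apply, sub_eq_iff_eq_add', Derivation.smul_apply]
    rcases v with i | j | ⟨j, S⟩
    · rw [← incl_X, extWeight_incl, extFlow_incl, extWeight_incl, extFlow_incl, weightDeriv_flow,
        map_add, map_smul]
    · change extWeight (extFlow k (tv j)) = extFlow k (extWeight (tv j)) +
        (2 * k + 1 : ℚ) • extFlow k (tv j)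
      rw [extWeight_tv, Derivation.map_smul, ← add_smul, extFlow_tv]
      split_ifs with hj
      · subst hj; simp
      · simp
    · change extWeight (extFlow k (gv j S)) = extFlow k (extWeight (gv j S)) +
        (2 * k + 1 : ℚ) • extFlow k (gv j S)
      rw [extWeight_gv, Derivation.map_smul, ← add_smul, extFlow_gv, extWeight_gv, mwt_cons]
      congr 1
      push_cast; ring
  have := congrArg (fun D : Derivation ℚ ExtPoly ExtPoly => D a) h
  simp only [Derivation.commutator_apply, Derivation.smul_apply] at this
  exact eq_add_of_sub_eq' this

/-- Homogeneity at the base point, checked on generators: `evalBase_del` for the jets, the value `t₀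
= -1` together with weight `-1` for the times, and the dilaton equation for the free energy
variables. -/
theorem extEval_extFlow_zero (a : ExtPoly) : extEval (extFlow 0 a) = extEval (extWeight a) := by
  induction a using MvPolynomial.induction_on with
  | C c => rw [MvPolynomial.derivation_C, MvPolynomial.derivation_C]
  | add p q hp hq => rw [map_add, map_add, hp, hq, map_add, map_add]
  | mul_X p v hp =>
    have hv : extEval (extFlow 0 (MvPolynomial.X v)) = extEval (extWeight (MvPolynomial.X v)) := by
      rcases v with i | j | ⟨j, S⟩
      · rw [← incl_X, extWeight_incl, extFlow_incl, extEval_incl, extEval_incl, flow_zero,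
          evalBase_del]
      · change extEval (extFlow 0 (tv j)) = extEval (extWeight (tv j))
        rw [extFlow_tv, extWeight_tv, map_smul, extEval_tv]
        split_ifs with hj
        · subst hj; simp
        · simp
      · change extEval (extFlow 0 (gv j S)) = extEval (extWeight (gv j S))
        rw [extFlow_gv, extWeight_gv, map_smul, extEval_gv, extEval_gv, Multiset.cons_swap,
          psi_zero_cons _ Multiset.cons_ne_zero, mwt_cons]
        push_cast
        rfl
    rw [Derivation.leibniz, Derivation.leibniz, map_add, map_add, smul_eq_mul, smul_eq_mul,
      smul_eq_mul, smul_eq_mul, map_mul, map_mul, map_mul, map_mul, hp, hv]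

/-- The composite of the extended flows indexed by `S`. -/
abbrev extFlows (S : Multiset ℕ) (a : ExtPoly) : ExtPoly := iterDeriv extFlow_comm S a

theorem extFlows_incl (S : Multiset ℕ) (a : DiffPoly) : extFlows S (incl a) = incl (flows S a) := by
  induction S using Multiset.induction_on with
  | empty => rfl
  | cons k S ih =>
    rw [extFlows, flows, iterDeriv_cons, iterDeriv_cons, ← extFlow_incl]
    exact congrArg _ ih

theorem extFlows_gv (S R : Multiset ℕ) (j : ℕ) : extFlows S (gv j R) = gv j (S + R) := by
  induction S using Multiset.induction_on with
  | empty => simp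
  | cons k S ih =>
    rw [Multiset.cons_add, ← extFlow_gv, ← ih, extFlows, iterDeriv_cons]

theorem extWeight_extFlows {a : ExtPoly} {w : ℚ} (ha : extWeight a = w • a) (S : Multiset ℕ) :
    extWeight (extFlows S a) = (w + mwt S) • extFlows S a := by
  induction S using Multiset.induction_on with
  | empty => simpa using ha
  | cons k S ih =>
    rw [extFlows, iterDeriv_cons, extWeight_extFlow, ih, Derivation.map_smul, ← add_smul, mwt_cons]
    congr 1
    push_cast; ring

/-- The ideal of elements all of whose derivatives along the first flows vanish at the base
point. -/
def flatIdeal (K : ℕ) : Ideal ExtPoly where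
  carrier := {a | ∀ S : Multiset ℕ, (∀ k ∈ S, k ≤ K) → extEval (extFlows S a) = 0}
  zero_mem' S _ := by rw [extFlows, iterDeriv_map_zero, map_zero]
  add_mem' {a b} ha hb S hS := by rw [extFlows, iterDeriv_add, map_add, ha S hS, hb S hS, add_zero]
  smul_mem' r a ha S hS := by
    -- By the Leibniz rule every term contains a derivative of `a` along a sub-multiset of `S`.
    rw [smul_eq_mul, extFlows, iterDeriv_mul, map_multiset_sum, Multiset.map_map]
    refine Multiset.sum_eq_zero fun x hx => ?_
    obtain ⟨p, hp, rfl⟩ := Multiset.mem_map.1 hx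
    have hp' := Multiset.mem_antidiagonal.1 hp
    rw [Function.comp_apply, map_mul,
      ha p.2 fun k hk => hS k (hp' ▸ Multiset.mem_add.2 (Or.inr hk)), mul_zero]

theorem extFlow_mem_flatIdeal {K k : ℕ} (hk : k ≤ K) {a : ExtPoly} (ha : a ∈ flatIdeal K) :
    extFlow k a ∈ flatIdeal K := by
  intro S hS
  rw [extFlows, iterDeriv_apply, ← iterDeriv_cons]
  refine ha _ fun j hj => ?_
  rcases Multiset.mem_cons.1 hj with rfl | hj
  exacts [hk, hS j hj]

/-- Integration in `x` without constants: at the base point two `x`-derivatives multiply the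
derivative of `a` along `S` by `v (v + 1)` with `v = w + mwt S > 0`. -/
theorem mem_flatIdeal_of_extFlow_extFlow_mem {K : ℕ} {a : ExtPoly} {w : ℚ} (hw : 0 < w)
    (ha : extWeight a = w • a) (h : extFlow 0 (extFlow 0 a) ∈ flatIdeal K) : a ∈ flatIdeal K := by
  intro S hS
  have h1 := extWeight_extFlows ha S
  have h2 := extWeight_extFlow 0 (extFlows S a)
  have h3 := h S hS
  rw [extFlows, iterDeriv_apply, iterDeriv_apply, extEval_extFlow_zero] at h3
  rw [h1, Derivation.map_smul, ← add_smul] at h2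
  rw [extFlows] at h1 h2
  rw [h2, map_smul, extEval_extFlow_zero, h1, map_smul, smul_smul, smul_eq_mul] at h3
  refine (mul_eq_zero.1 h3).resolve_left ?_
  push_cast
  positivity

theorem gv_sub_mem_flatIdeal {K : ℕ} {a : ExtPoly} {j : ℕ} {R : Multiset ℕ}
    (h : ∀ S, extEval (extFlows S a) = psi (j ::ₘ (S + R))) : gv j R - a ∈ flatIdeal K := by
  intro S _
  rw [extFlows, iterDeriv_sub, map_sub, sub_eq_zero]
  exact (by rw [extFlows_gv, extEval_gv] : extEval (extFlows S (gv j R)) = _).trans (h S).symm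

/-! ### Virasoro constraints -/

/-- With `z = λ⁻¹` and `E = d/dz`, the operator `-z² E` is `d/dλ`. Divided by `z`, the Lenard
operator depends on `λ` only through `-4 λ D`, so differentiating the equation in `λ` leaves `4 D
b`. -/
theorem lenard_neg_sq_mul_derivation {B : Type*} [CommRing B] [Algebra ℚ B]
    {D E : Derivation ℚ B B} {z v b : B} (hDz : D z = 0) (hEz : E z = 1) (hEv : E v = 0)
    (hcomm : ∀ f, E (D f) = D (E f)) (hb : lenard D z v b = 0) :
    lenard D z v (- (z ^ 2 * E b)) = 4 * z * D b := by
  have h := congrArg E hb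
  rw [lenard] at h hb ⊢
  simp only [map_sub, map_add, map_neg, map_zero, Derivation.leibniz, Derivation.leibniz_pow, hDz,
    hEz, hEv, hcomm, derivation_two, derivation_four, smul_eq_mul, nsmul_eq_mul,
    Derivation.map_one_eq_zero] at h ⊢
  linear_combination - z ^ 2 * h + z * hb

/-- The derivative of the resolvent with respect to `λ`. -/
def resolventLambda : PowerSeries DiffPoly :=
  - (PowerSeries.X ^ 2 * PowerSeries.derivative DiffPoly resolvent)

theorem lenard_resolventLambda :
    lenard (seriesDeriv del) PowerSeries.X (PowerSeries.C (MvPolynomial.X 0)) resolventLambda =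
      4 * PowerSeries.X * seriesDeriv del resolvent :=
  lenard_neg_sq_mul_derivation (E := (PowerSeries.derivative DiffPoly).restrictScalars ℚ)
    (seriesDeriv_X _) PowerSeries.derivative_X PowerSeries.derivative_C
    (fun f => (seriesDeriv_derivative del f).symm) lenard_resolvent

/-- The operator `λ⁻¹ d/dλ⁻¹` multiplies the coefficient `β_i` by `i`, so this is `sum_flow_beta`;
its last term vanishes because `β₀ = 1`. -/
theorem coeff_wronskian_resolventLambda (m : ℕ) :
    PowerSeries.coeff (m + 1) (resolventLambda * seriesDeriv del resolvent -
      resolvent * seriesDeriv del resolventLambda) =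
      ∑ a ∈ Finset.range m, flow a (beta (m - 1 - a + 1)) := by
  have e : resolventLambda * seriesDeriv del resolvent -
      resolvent * seriesDeriv del resolventLambda = PowerSeries.X *
        (PowerSeries.X * seriesDeriv del (PowerSeries.derivative DiffPoly resolvent) * resolvent -
          PowerSeries.X * PowerSeries.derivative DiffPoly resolvent *
            seriesDeriv del resolvent) := by
    rw [resolventLambda, map_neg, seriesDeriv_X_pow_mul]
    ring
  have hc : ∀ (f : PowerSeries DiffPoly) (n : ℕ), PowerSeries.coeff n
      (PowerSeries.X * PowerSeries.derivative DiffPoly f) = n * PowerSeries.coeff n f := by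
    intro f n
    cases n with
    | zero => simp
    | succ n =>
      rw [PowerSeries.coeff_succ_X_mul, PowerSeries.coeff_derivative]
      push_cast; ring
  have h1 := sum_flow_beta m
  rw [Finset.Nat.sum_antidiagonal_eq_sum_range_succ (fun i j => flow i (beta j)),
    Finset.sum_range_succ, Nat.sub_self, beta_zero, Derivation.map_one_eq_zero, add_zero] at h1
  rw [e, PowerSeries.coeff_succ_X_mul, map_sub, PowerSeries.coeff_mul, PowerSeries.coeff_mul,
    ← Finset.sum_sub_distrib, seriesDeriv_derivative]
  refine Eq.trans ?_ (h1.symm.trans ?_)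
  · refine Finset.sum_congr rfl fun p _ => ?_
    rw [hc, hc, coeff_seriesDeriv, coeff_seriesDeriv]
    simp only [beta]
    ring
  · refine Finset.sum_congr rfl fun a ha => ?_
    have := Finset.mem_range.1 ha
    rw [show m - 1 - a + 1 = m - a by omega]

/-- Twice the `m`-th Virasoro expression, with times `t₀, …, t_K`. -/
def virasoro (K m : ℕ) : ExtPoly :=
  2 * ∑ k ∈ Finset.range (K + 1), (2 * k + 1 : ℚ) • (tv k * gv (k + m) 0) +
    ∑ a ∈ Finset.range m, (gv a {m - 1 - a} + gv a 0 * gv (m - 1 - a) 0)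

theorem extFlow_timeSum {K j : ℕ} (hj : j ≤ K) (x : ℕ → ExtPoly) :
    extFlow j (∑ k ∈ Finset.range (K + 1), (2 * k + 1 : ℚ) • (tv k * x k)) =
      (2 * j + 1 : ℚ) • x j +
        ∑ k ∈ Finset.range (K + 1), (2 * k + 1 : ℚ) • (tv k * extFlow j (x k)) := by
  have h : ∀ k ∈ Finset.range (K + 1), extFlow j ((2 * k + 1 : ℚ) • (tv k * x k)) =
      (if k = j then (2 * j + 1 : ℚ) • x j else 0) +
        (2 * k + 1 : ℚ) • (tv k * extFlow j (x k)) := by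
    intro k _
    rw [Derivation.map_smul, Derivation.leibniz, extFlow_tv, smul_add, add_comm]
    split_ifs with h
    · subst h; simp
    · simp
  rw [map_sum, Finset.sum_congr rfl h, Finset.sum_add_distrib, Finset.sum_ite_eq',
    if_pos (Finset.mem_range.2 (Nat.lt_succ_of_le hj))]

/-- At most one flow in `S` can act on the linear factor `t_k`; that flow must have index `k`, and
it is then removed from `S`. -/
theorem extFlows_timeSum {K : ℕ} (x : ℕ → ExtPoly) (S : Multiset ℕ) (hS : ∀ k ∈ S, k ≤ K) :
    extFlows S (∑ k ∈ Finset.range (K + 1), (2 * k + 1 : ℚ) • (tv k * x k)) =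
      (S.map fun d : ℕ => (2 * d + 1 : ℚ) • extFlows (S.erase d) (x d)).sum +
        ∑ k ∈ Finset.range (K + 1), (2 * k + 1 : ℚ) • (tv k * extFlows S (x k)) := by
  induction S using Multiset.induction_on with
  | empty => simp
  | cons j S ih =>
    have hj : j ≤ K := hS j (Multiset.mem_cons_self j S)
    have ih := ih fun k hk => hS k (Multiset.mem_cons_of_mem hk)
    simp only [extFlows, iterDeriv_cons] at ih ⊢
    rw [ih, map_add, extFlow_timeSum hj, map_multiset_sum, Multiset.map_map, Multiset.map_cons,
      Multiset.sum_cons, Multiset.erase_cons_head, ← add_assoc, add_comm _ ((2 * j + 1 : ℚ) • _)]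
    congr 2
    refine congrArg Multiset.sum (Multiset.map_congr rfl fun d hd => ?_)
    have e : (j ::ₘ S).erase d = j ::ₘ S.erase d := by
      rcases eq_or_ne d j with rfl | h
      · rw [Multiset.erase_cons_head, Multiset.cons_erase hd]
      · exact Multiset.erase_cons_tail S (Ne.symm h)
    rw [Function.comp_apply, Derivation.map_smul, e, iterDeriv_cons]

/-! ### The loop equation modulo flat elements -/

section Quotient

variable (K : ℕ)

/-- The projection to the quotient by the ideal of flat elements. -/
abbrev proj : ExtPoly →+* ExtPoly ⧸ flatIdeal K := Ideal.Quotient.mk (flatIdeal K)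

/-- The derivation induced by the zeroth flow on the quotient. -/
def quotDel : Derivation ℚ (ExtPoly ⧸ flatIdeal K) (ExtPoly ⧸ flatIdeal K) :=
  Derivation.liftOfSurjective (f := Ideal.Quotient.mkₐ ℚ (flatIdeal K)) (d := extFlow 0)
    (Ideal.Quotient.mkₐ_surjective ℚ _) fun _ hx =>
      Ideal.Quotient.eq_zero_iff_mem.2
        (extFlow_mem_flatIdeal (Nat.zero_le K) (Ideal.Quotient.eq_zero_iff_mem.1 hx))

theorem quotDel_proj (a : ExtPoly) : quotDel K (proj K a) = proj K (extFlow 0 a) :=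
  Derivation.liftOfSurjective_apply (f := Ideal.Quotient.mkₐ ℚ (flatIdeal K))
    (Ideal.Quotient.mkₐ_surjective ℚ _)
    (fun _ hx => Ideal.Quotient.eq_zero_iff_mem.2
      (extFlow_mem_flatIdeal (Nat.zero_le K) (Ideal.Quotient.eq_zero_iff_mem.1 hx))) a

/-- The image of differential polynomials in the quotient. -/
def quotIncl : DiffPoly →+* ExtPoly ⧸ flatIdeal K := (proj K).comp incl.toRingHom

theorem quotIncl_apply (a : DiffPoly) : quotIncl K a = proj K (incl a) := rfl

theorem quotDel_quotIncl (a : DiffPoly) : quotDel K (quotIncl K a) = quotIncl K (del a) := by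
  rw [quotIncl_apply, quotDel_proj, extFlow_incl, flow_zero, quotIncl_apply]

theorem seriesDeriv_map_quotIncl (f : PowerSeries DiffPoly) :
    seriesDeriv (quotDel K) (PowerSeries.map (quotIncl K) f) =
      PowerSeries.map (quotIncl K) (seriesDeriv del f) := by
  ext1 n
  rw [coeff_seriesDeriv, PowerSeries.coeff_map, quotDel_quotIncl, PowerSeries.coeff_map,
    coeff_seriesDeriv]

theorem lenard_map_quotIncl (f : PowerSeries DiffPoly) :
    lenard (seriesDeriv (quotDel K)) PowerSeries.X
      (PowerSeries.C (quotIncl K (MvPolynomial.X 0))) (PowerSeries.map (quotIncl K) f) =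
      PowerSeries.map (quotIncl K) (lenard (seriesDeriv del) PowerSeries.X
        (PowerSeries.C (MvPolynomial.X 0)) f) := by
  simp only [lenard, seriesDeriv_map_quotIncl, seriesDeriv_C, quotDel_quotIncl, map_add, map_sub,
    map_mul, map_one, map_ofNat, PowerSeries.map_X, PowerSeries.map_C]

/-- The series `λ⁻ᴷ (∑ (2k + 1) tₖ λᵏ + ∑ Fₖ λ⁻ᵏ⁻¹)`. -/
def currentSeries : PowerSeries (ExtPoly ⧸ flatIdeal K) :=
  PowerSeries.mk fun n =>
    if n ≤ K then proj K ((2 * (K - n : ℕ) + 1 : ℚ) • tv (K - n)) else proj K (gv (n - K - 1) 0)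

/-- The relation `∂ F_a = β_{a+1}`. In the extended ring the two sides are independent, but by
`psi_zero_cons_cons` they have the same derivatives at the base point, so they agree modulo flat
elements. -/
theorem proj_gv_zero (a : ℕ) : proj K (gv a {0}) = quotIncl K (beta (a + 1)) := by
  rw [quotIncl_apply, ← sub_eq_zero, ← map_sub]
  refine Ideal.Quotient.eq_zero_iff_mem.2 (gv_sub_mem_flatIdeal fun S => ?_)
  rw [extFlows_incl, extEval_incl, ← psi_zero_cons_cons, add_comm S, Multiset.singleton_add,
    Multiset.cons_swap]

theorem proj_gv_zero_cons (a b : ℕ) :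
    proj K (gv a (0 ::ₘ {b})) = quotIncl K (flow a (beta (b + 1))) := by
  rw [quotIncl_apply, ← sub_eq_zero, ← map_sub]
  refine Ideal.Quotient.eq_zero_iff_mem.2 (gv_sub_mem_flatIdeal fun S => ?_)
  rw [extFlows_incl, extEval_incl, flows, iterDeriv_apply, ← iterDeriv_cons, ← flows,
    ← psi_zero_cons_cons, add_comm S, Multiset.cons_add, Multiset.singleton_add,
    Multiset.cons_swap a 0, Multiset.cons_swap a b]

/-- The only time with nonzero `x`-derivative is `t₀`, which supplies `β₀ = 1` at order `λ⁻ᴷ`; the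
`F_k` supply the other `β_{k+1}`. -/
theorem seriesDeriv_currentSeries :
    seriesDeriv (quotDel K) (currentSeries K) =
      PowerSeries.X ^ K * PowerSeries.map (quotIncl K) resolvent := by
  ext1 n
  rw [coeff_seriesDeriv, currentSeries, PowerSeries.coeff_mk, PowerSeries.coeff_X_pow_mul']
  rcases lt_trichotomy n K with h | h | h
  · rw [if_pos h.le, if_neg (by omega), quotDel_proj, Derivation.map_smul, extFlow_tv,
      if_neg (by omega), smul_zero, map_zero]
  · subst h
    rw [if_pos le_rfl, if_pos le_rfl, quotDel_proj, Derivation.map_smul, extFlow_tv,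
      if_pos (Nat.sub_self n), Nat.sub_self, PowerSeries.coeff_map]
    change _ = quotIncl n (beta 0)
    rw [beta_zero, map_one]
    simp
  · rw [if_neg (by omega), if_pos h.le, quotDel_proj, extFlow_gv, PowerSeries.coeff_map]
    change proj K (gv _ {0}) = quotIncl K (beta _)
    rw [proj_gv_zero, show n - K - 1 + 1 = n - K by omega]

/-- The generating series of the derivatives of the Virasoro expressions. -/
def loopSeries : PowerSeries (ExtPoly ⧸ flatIdeal K) :=
  PowerSeries.X ^ K *
      (PowerSeries.map (quotIncl K) resolventLambda *
          seriesDeriv (quotDel K) (PowerSeries.map (quotIncl K) resolvent) -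
        PowerSeries.map (quotIncl K) resolvent *
          seriesDeriv (quotDel K) (PowerSeries.map (quotIncl K) resolventLambda)) +
    2 * (PowerSeries.map (quotIncl K) resolvent * currentSeries K)

/-- This is `lenard_loop` with `f = db/dλ`, the current as `s`, and `q = λ⁻ᴷ`. Beyond order `K` the
right-hand side vanishes, so the coefficients obey a homogeneous Lenard recursion. -/
theorem lenard_loopSeries :
    lenard (seriesDeriv (quotDel K)) PowerSeries.X
      (PowerSeries.C (quotIncl K (MvPolynomial.X 0))) (loopSeries K) =
      -8 * PowerSeries.X ^ K := by
  refine lenard_loop (seriesDeriv_X _) (seriesDeriv_X_pow _ _) ?_ ?_ ?_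
    (seriesDeriv_currentSeries K)
  · have h := congrArg (PowerSeries.map (quotIncl K)) resolvent_equation
    simpa only [← seriesDeriv_map_quotIncl, map_add, map_sub, map_neg, map_pow,
      map_mul, map_one, map_ofNat, PowerSeries.map_X, PowerSeries.map_C] using h
  · rw [lenard_map_quotIncl, lenard_resolvent, map_zero]
  · rw [lenard_map_quotIncl, lenard_resolventLambda, seriesDeriv_map_quotIncl, map_mul, map_mul,
      map_ofNat, PowerSeries.map_X]

/-- The Wronskian part contributes the second derivatives `F_{a,b}`, and twice the product of the
resolvent with the current contributes the terms with times and the products `F_a F_b`. -/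
theorem coeff_loopSeries (m : ℕ) :
    PowerSeries.coeff (K + m + 1) (loopSeries K) = proj K (extFlow 0 (virasoro K m)) := by
  have h1 : PowerSeries.coeff (K + m + 1) (PowerSeries.X ^ K *
      (PowerSeries.map (quotIncl K) resolventLambda *
          seriesDeriv (quotDel K) (PowerSeries.map (quotIncl K) resolvent) -
        PowerSeries.map (quotIncl K) resolvent *
          seriesDeriv (quotDel K) (PowerSeries.map (quotIncl K) resolventLambda))) =
      ∑ a ∈ Finset.range m, proj K (gv a (0 ::ₘ {m - 1 - a})) := by
    rw [show K + m + 1 = (m + 1) + K by ring, PowerSeries.coeff_X_pow_mul,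
      seriesDeriv_map_quotIncl, seriesDeriv_map_quotIncl, ← map_mul, ← map_mul, ← map_sub,
      PowerSeries.coeff_map, coeff_wronskian_resolventLambda, map_sum]
    exact Finset.sum_congr rfl fun a _ => (proj_gv_zero_cons K a _).symm
  have h2 : PowerSeries.coeff (K + m + 1)
      (2 * (PowerSeries.map (quotIncl K) resolvent * currentSeries K)) =
      2 * (proj K (gv m 0) +
        ∑ a ∈ Finset.range m, proj K (gv a {0}) * proj K (gv (m - 1 - a) 0) +
        ∑ k ∈ Finset.range (K + 1), proj K ((2 * k + 1 : ℚ) • (tv k * gv (k + m) {0}))) := by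
    have e2 : (2 : PowerSeries (ExtPoly ⧸ flatIdeal K)) = PowerSeries.C 2 := (map_ofNat _ 2).symm
    rw [e2, PowerSeries.coeff_C_mul, PowerSeries.coeff_mul,
      Finset.Nat.sum_antidiagonal_eq_sum_range_succ (fun i j =>
        PowerSeries.coeff i (PowerSeries.map (quotIncl K) resolvent) *
          PowerSeries.coeff j (currentSeries K)),
      show (K + m + 1).succ = (m + 1) + (K + 1) by omega, Finset.sum_range_add,
      Finset.sum_range_succ']
    congr 2
    · rw [add_comm]
      congr 1
      · rw [PowerSeries.coeff_map, currentSeries, PowerSeries.coeff_mk, if_neg (by omega),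
          show K + m + 1 - 0 - K - 1 = m by omega]
        change quotIncl K (beta 0) * _ = _
        rw [beta_zero, map_one, one_mul]
      · refine Finset.sum_congr rfl fun a ha => ?_
        have := Finset.mem_range.1 ha
        rw [PowerSeries.coeff_map, currentSeries, PowerSeries.coeff_mk, if_neg (by omega),
          show K + m + 1 - (a + 1) - K - 1 = m - 1 - a by omega, proj_gv_zero]
        rfl
    · refine Finset.sum_congr rfl fun k hk => ?_
      have := Finset.mem_range.1 hk
      rw [PowerSeries.coeff_map, currentSeries, PowerSeries.coeff_mk, if_pos (by omega),
        show K - (K + m + 1 - (m + 1 + k)) = k by omega, ← smul_mul_assoc, map_mul, proj_gv_zero,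
        mul_comm, show m + 1 + k = k + m + 1 by ring]
      rfl
  have h3 : extFlow 0 (virasoro K m) =
      2 * (gv m 0 + ∑ k ∈ Finset.range (K + 1), (2 * k + 1 : ℚ) • (tv k * gv (k + m) {0})) +
      ∑ a ∈ Finset.range m, (gv a (0 ::ₘ {m - 1 - a}) +
        (gv a {0} * gv (m - 1 - a) 0 + gv a 0 * gv (m - 1 - a) {0})) := by
    rw [virasoro, map_add, Derivation.leibniz, derivation_two, extFlow_timeSum (Nat.zero_le K)]
    simp only [smul_eq_mul, add_zero, mul_zero, map_sum, map_add, extFlow_gv, Derivation.leibniz,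
      zero_add, CharP.cast_eq_zero, one_smul]
    congr 1
    refine Finset.sum_congr rfl fun a _ => ?_
    change _ + (gv a 0 * gv (m - 1 - a) {0} + gv (m - 1 - a) 0 * gv a {0}) = _
    ring
  rw [loopSeries, map_add, h1, h2, h3]
  have h4 : ∑ a ∈ Finset.range m, gv a 0 * gv (m - 1 - a) {0} =
      ∑ a ∈ Finset.range m, gv a {0} * gv (m - 1 - a) 0 := by
    rw [← Finset.sum_range_reflect]
    refine Finset.sum_congr rfl fun a ha => ?_
    have := Finset.mem_range.1 ha
    rw [show m - 1 - (m - 1 - a) = a by omega, mul_comm]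
  rw [Finset.sum_add_distrib, Finset.sum_add_distrib, h4]
  simp only [map_add, map_mul, map_sum, map_ofNat]
  ring

end Quotient

/-! ### Virasoro constraints by induction on the index -/

theorem extEval_extFlows_timeSum {K : ℕ} (m : ℕ) (S : Multiset ℕ) (hS : ∀ k ∈ S, k ≤ K) :
    extEval (extFlows S (∑ k ∈ Finset.range (K + 1), (2 * k + 1 : ℚ) • (tv k * gv (k + m) 0))) =
      (S.map fun d : ℕ => (2 * d + 1 : ℚ) * psi ((d + m) ::ₘ S.erase d)).sum - psi (m ::ₘ S) := by
  rw [extFlows_timeSum _ S hS, map_add, map_multiset_sum, Multiset.map_map, map_sum,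
    sub_eq_add_neg]
  congr 1
  · refine congrArg Multiset.sum (Multiset.map_congr rfl fun d _ => ?_)
    rw [Function.comp_apply, extFlows_gv, map_smul, extEval_gv, add_zero, smul_eq_mul]
  · rw [Finset.sum_eq_single 0]
    · simp [extFlows_gv, extEval_gv, extEval_tv]
    · intro k _ hk
      simp [extEval_tv, hk]
    · simp

/-- For index zero every term of the sum over parts equals `(2d + 1) * psi`, and the total cancels
by the dilaton equation. The extra `x`-derivative keeps the multiset nonempty; without it the value
at the base point is nonzero. -/
theorem extFlow_virasoro_zero_mem (K : ℕ) : extFlow 0 (virasoro K 0) ∈ flatIdeal K := by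
  intro S hS
  have h := extEval_extFlows_timeSum (K := K) 0 (0 ::ₘ S) (by
    intro k hk
    rcases Multiset.mem_cons.1 hk with rfl | hk
    exacts [Nat.zero_le K, hS k hk])
  have h2 : ((0 ::ₘ S).map fun d : ℕ => (2 * d + 1 : ℚ) * psi ((d + 0) ::ₘ (0 ::ₘ S).erase d)).sum =
      mwt (0 ::ₘ S) * psi (0 ::ₘ S) := by
    have : ∀ d ∈ 0 ::ₘ S, (2 * d + 1 : ℚ) * psi ((d + 0) ::ₘ (0 ::ₘ S).erase d) =
        (2 * d + 1 : ℚ) * psi (0 ::ₘ S) := fun d hd => by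
      rw [add_zero, Multiset.cons_erase hd]
    rw [Multiset.map_congr rfl this, Multiset.sum_map_mul_right, mwt]
    congr 1
    rw [Nat.cast_multiset_sum, Multiset.map_map]
    simp
  rw [h2, psi_zero_cons _ Multiset.cons_ne_zero, sub_self] at h
  rw [extFlows, iterDeriv_apply, ← iterDeriv_cons, virasoro, Finset.sum_range_zero, add_zero,
    iterDeriv_two_mul, map_mul]
  exact mul_eq_zero_of_right _ h

theorem extWeight_virasoro (K m : ℕ) :
    extWeight (virasoro K m) = (2 * m : ℚ) • virasoro K m := by
  rw [virasoro, smul_add, map_add, Derivation.leibniz, derivation_two, smul_zero, add_zero,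
    smul_eq_mul, map_sum, map_sum, ← mul_smul_comm, Finset.smul_sum, Finset.smul_sum]
  congr 1
  · congr 1
    refine Finset.sum_congr rfl fun k _ => ?_
    rw [Derivation.map_smul, Derivation.leibniz, extWeight_gv, extWeight_tv, smul_eq_mul,
      smul_eq_mul, mul_smul_comm, mul_smul_comm, mul_comm (gv _ _), ← add_smul, smul_comm]
    congr 2
    rw [mwt_zero]; push_cast; ring
  · refine Finset.sum_congr rfl fun a ha => ?_
    have ha := Finset.mem_range.1 ha
    have hc : ((m - 1 - a : ℕ) : ℚ) = m - 1 - a := by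
      rw [Nat.cast_sub (by omega), Nat.cast_sub (by omega)]; simp
    rw [map_add, Derivation.leibniz, extWeight_gv, extWeight_gv, extWeight_gv, smul_eq_mul,
      smul_eq_mul, mul_smul_comm, mul_smul_comm, mul_comm (gv (m - 1 - a) _), ← add_smul, smul_add,
      mwt_zero, ← Multiset.cons_zero, mwt_cons, mwt_zero]
    congr 2
    · push_cast; rw [hc]; ring
    · push_cast; rw [hc]; ring

/-- If the `x`-derivative of the `m`-th expression is flat, the Lenard recursion makes the second
`x`-derivative of the next one flat. That expression has weight `2 (m + 1) > 0`, so it can be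
integrated back. -/
theorem extFlow_virasoro_mem (K m : ℕ) : extFlow 0 (virasoro K m) ∈ flatIdeal K := by
  induction m with
  | zero => exact extFlow_virasoro_zero_mem K
  | succ m ih =>
    have h := congrArg (PowerSeries.coeff (K + m + 1 + 1)) (lenard_loopSeries K)
    have e8 : (-8 : PowerSeries (ExtPoly ⧸ flatIdeal K)) = PowerSeries.C (-8) := by
      rw [map_neg, map_ofNat]
    rw [coeff_succ_lenard, coeff_loopSeries, show K + m + 1 + 1 = K + (m + 1) + 1 by ring,
      coeff_loopSeries, Ideal.Quotient.eq_zero_iff_mem.2 ih, e8, PowerSeries.coeff_C_mul,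
      PowerSeries.coeff_X_pow, if_neg (by omega), quotDel_proj] at h
    simp only [map_zero, mul_zero, add_zero, zero_sub] at h
    have h4 : proj K (extFlow 0 (extFlow 0 (virasoro K (m + 1)))) = 0 := by
      have e : ∀ x : ExtPoly ⧸ flatIdeal K, (1 / 4 : ℚ) • (4 * x) = x := by
        intro x
        have : (4 : ExtPoly ⧸ flatIdeal K) * x = (4 : ℚ) • x := by
          rw [show (4 : ℚ) = 1 + 1 + 1 + 1 by norm_num, add_smul, add_smul, add_smul, one_smul]
          ring
        rw [this, smul_smul]
        norm_num
      rw [← e (proj K _), neg_eq_zero.1 h, smul_zero]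
    refine extFlow_mem_flatIdeal (Nat.zero_le K) (mem_flatIdeal_of_extFlow_extFlow_mem
      (w := 2 * (m + 1 : ℕ)) (by positivity) (extWeight_virasoro K (m + 1))
      (Ideal.Quotient.eq_zero_iff_mem.1 h4))

theorem virasoro_mem (K m : ℕ) : virasoro K (m + 1) ∈ flatIdeal K :=
  mem_flatIdeal_of_extFlow_extFlow_mem (w := 2 * (m + 1 : ℕ)) (by positivity)
    (extWeight_virasoro K (m + 1))
    (extFlow_mem_flatIdeal (Nat.zero_le K) (extFlow_virasoro_mem K (m + 1)))

/-- The cut-and-join recursion. -/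
theorem psi_succ_cons (m : ℕ) (S : Multiset ℕ) :
    2 * psi ((m + 1) ::ₘ S) =
      2 * (S.map fun d : ℕ => (2 * d + 1 : ℚ) * psi ((d + (m + 1)) ::ₘ S.erase d)).sum +
      ∑ a ∈ Finset.range (m + 1), (psi (a ::ₘ (m - a) ::ₘ S) +
        (S.antidiagonal.map fun p => psi (a ::ₘ p.1) * psi ((m - a) ::ₘ p.2)).sum) := by
  -- Truncating the times at `K = S.sum` loses nothing, since no flow in `S` has a larger index.
  have hS : ∀ k ∈ S, k ≤ S.sum := fun k hk => Multiset.single_le_sum (fun _ _ => Nat.zero_le _) k hk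
  have h := virasoro_mem S.sum m S hS
  have h1 := extEval_extFlows_timeSum (m + 1) S hS
  rw [virasoro, extFlows, iterDeriv_add, iterDeriv_two_mul, map_add, map_mul, map_ofNat, h1,
    iterDeriv_sum, map_sum] at h
  have h2 : ∀ a ∈ Finset.range (m + 1), extEval (iterDeriv extFlow_comm S
      (gv a {m + 1 - 1 - a} + gv a 0 * gv (m + 1 - 1 - a) 0)) = psi (a ::ₘ (m - a) ::ₘ S) +
        (S.antidiagonal.map fun p => psi (a ::ₘ p.1) * psi ((m - a) ::ₘ p.2)).sum := by
    intro a _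
    rw [iterDeriv_add, iterDeriv_mul, map_add, Nat.add_sub_cancel, map_multiset_sum,
      Multiset.map_map]
    congr 1
    · change extEval (extFlows S _) = _
      rw [extFlows_gv, extEval_gv, add_comm S, Multiset.singleton_add]
    · refine congrArg Multiset.sum (Multiset.map_congr rfl fun p _ => ?_)
      change extEval (extFlows _ _ * extFlows _ _) = _
      rw [extFlows_gv, extFlows_gv, map_mul, extEval_gv, extEval_gv, add_zero, add_zero]
  rw [Finset.sum_congr rfl h2] at h
  linear_combination -h

/-! ### Sums of reciprocal binomial coefficients -/

theorem choose_mul_choose_le (m n i j : ℕ) :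
    m.choose i * n.choose j ≤ (m + n).choose (i + j) := by
  rw [Nat.add_choose_eq]
  exact Finset.single_le_sum (f := fun p : ℕ × ℕ => m.choose p.1 * n.choose p.2)
    (fun _ _ => Nat.zero_le _) (Finset.HasAntidiagonal.mem_antidiagonal.2 rfl : (i, j) ∈ _)

theorem le_choose {n r : ℕ} (h0 : 1 ≤ r) (h1 : r + 1 ≤ n) : n ≤ n.choose r := by
  induction n generalizing r with
  | zero => omega
  | succ n ih =>
    obtain ⟨r, rfl⟩ : ∃ s, r = s + 1 := ⟨r - 1, by omega⟩
    rw [Nat.choose_succ_succ']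
    rcases Nat.lt_or_ge (r + 1) n with h | h
    · have := ih h0 (by omega)
      have := Nat.choose_pos (show r ≤ n by omega)
      omega
    · have : n = r + 1 := by omega
      subst this
      simp

/-- The two end terms are `1`; each of the fewer than `n` interior terms is at most `1 / n`. -/
theorem sum_inv_choose_sq_le (n : ℕ) :
    ∑ r ∈ Finset.range (n + 1), (1 / ((n.choose r : ℝ) ^ 2)) ≤ 3 := by
  rcases n with _ | n
  · norm_num
  · rw [Finset.sum_range_succ, Finset.sum_range_succ']
    have h : ∀ r ∈ Finset.range n, (1 / (((n + 1).choose (r + 1) : ℝ) ^ 2)) ≤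
        1 / ((n : ℝ) + 1) := by
      intro r hr
      have hr := Finset.mem_range.1 hr
      have h1 : (n : ℝ) + 1 ≤ ((n + 1).choose (r + 1) : ℝ) := by
        exact_mod_cast le_choose (n := n + 1) (r := r + 1) (by omega) (by omega)
      refine one_div_le_one_div_of_le (by positivity) ?_
      have h2 : (0 : ℝ) ≤ n := Nat.cast_nonneg n
      nlinarith
    have h2 := Finset.sum_le_sum h
    rw [Finset.sum_const, Finset.card_range, nsmul_eq_mul] at h2
    have h3 : (n : ℝ) * (1 / (n + 1)) ≤ 1 := by
      rw [mul_one_div, div_le_one (by positivity)]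
      linarith
    simp only [Nat.choose_zero_right, Nat.choose_self, Nat.cast_one, one_pow, div_one]
    linarith

theorem sum_antidiagonal_card (S : Multiset ℕ) (g : ℕ → ℝ) :
    (S.antidiagonal.map fun p => g p.1.card).sum =
      ∑ r ∈ Finset.range (S.card + 1), (S.card.choose r : ℝ) * g r := by
  induction S using Multiset.induction_on generalizing g with
  | empty => simp
  | cons a S ih =>
    rw [Multiset.antidiagonal_cons, Multiset.map_add, Multiset.sum_add, Multiset.map_map,
      Multiset.map_map, Multiset.card_cons]
    have h := Finset.sum_choose_succ_mul (fun i _ => g i) S.card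
    rw [h, ← ih, ← ih fun i => g (i + 1)]
    simp

theorem mwt_eq (S : Multiset ℕ) : mwt S = 2 * S.sum + S.card := by
  induction S using Multiset.induction_on with
  | empty => rfl
  | cons a S ih => rw [mwt_cons, ih, Multiset.sum_cons, Multiset.card_cons]; ring

theorem mwt_add (S T : Multiset ℕ) : mwt (S + T) = mwt S + mwt T := by
  simp [mwt]

theorem card_le_sum {S : Multiset ℕ} (hS : ∀ d ∈ S, 1 ≤ d) : S.card ≤ S.sum := by
  simpa using Multiset.card_nsmul_le_sum hS

/-- Parts at least `1` have weight at least `3`, so three copies of the cardinalities fit inside the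
weights, and Vandermonde's inequality `choose_mul_choose_le` applies to each copy. -/
theorem choose_card_pow_le {I J : Multiset ℕ} (hI : ∀ d ∈ I, 1 ≤ d) (hJ : ∀ d ∈ J, 1 ≤ d) :
    (I.card + J.card).choose I.card ^ 3 ≤ (mwt I + mwt J).choose (mwt I) := by
  obtain ⟨x, hx⟩ := Nat.exists_eq_add_of_le (card_le_sum hI)
  obtain ⟨y, hy⟩ := Nat.exists_eq_add_of_le (card_le_sum hJ)
  set i := I.card
  set j := J.card
  have e1 : mwt I = i + (i + (i + 2 * x)) := by rw [mwt_eq, hx]; ring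
  have e2 : mwt I + mwt J = (i + j) + ((i + j) + ((i + j) + (2 * x + 2 * y))) := by
    rw [mwt_eq, mwt_eq, hx, hy]; ring
  rw [e2, e1]
  calc (i + j).choose i ^ 3
      = (i + j).choose i * ((i + j).choose i * ((i + j).choose i * 1)) := by ring
    _ ≤ (i + j).choose i * ((i + j).choose i * ((i + j).choose i *
          (2 * x + 2 * y).choose (2 * x))) := by
        gcongr
        exact Nat.choose_pos (by omega)
    _ ≤ (i + j).choose i * ((i + j).choose i * ((i + j) + (2 * x + 2 * y)).choose (i + 2 * x)) := by
        gcongr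
        exact choose_mul_choose_le _ _ _ _
    _ ≤ (i + j).choose i * ((i + j) + ((i + j) + (2 * x + 2 * y))).choose (i + (i + 2 * x)) := by
        gcongr
        exact choose_mul_choose_le _ _ _ _
    _ ≤ _ := choose_mul_choose_le _ _ _ _

/-- The total weight of all splittings is bounded. -/
theorem sum_split_le (m : ℕ) {S : Multiset ℕ} (hS : ∀ d ∈ S, 1 ≤ d) :
    ∑ a ∈ Finset.range (m + 1), (S.antidiagonal.map fun p =>
      (1 / ((2 * m + mwt S).choose (2 * a + mwt p.1) : ℝ))).sum ≤ 9 := by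
  -- There are `S.card.choose r` splittings with first part of size `r`. This multiplicity cancels
  -- one of the three powers, leaving a sum of inverse squares, which is at most `3`.
  have h1 : ∀ a ∈ Finset.range (m + 1), (S.antidiagonal.map fun p =>
      (1 / ((2 * m + mwt S).choose (2 * a + mwt p.1) : ℝ))).sum ≤
      1 / ((m.choose a : ℝ) ^ 2) * 3 := by
    intro a ha
    have ha := Finset.mem_range.1 ha
    have hpos : 0 < m.choose a := Nat.choose_pos (by omega)
    calc _ ≤ (S.antidiagonal.map fun p : Multiset ℕ × Multiset ℕ => 1 / ((m.choose a : ℝ) ^ 2) *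
          (1 / ((S.card.choose p.1.card : ℝ) ^ 3))).sum := by
          refine Multiset.sum_map_le_sum_map _ _ fun p hp => ?_
          have hp := Multiset.mem_antidiagonal.1 hp
          have hI : ∀ d ∈ p.1, 1 ≤ d := fun d hd => hS d (hp ▸ Multiset.mem_add.2 (Or.inl hd))
          have hJ : ∀ d ∈ p.2, 1 ≤ d := fun d hd => hS d (hp ▸ Multiset.mem_add.2 (Or.inr hd))
          have h3 := choose_card_pow_le hI hJ
          rw [← Multiset.card_add, hp, ← mwt_add, hp] at h3
          have h4 : m.choose a ^ 2 ≤ (2 * m).choose (2 * a) := by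
            rw [two_mul, two_mul, sq]
            exact choose_mul_choose_le _ _ _ _
          have hcard : p.1.card ≤ S.card := by rw [← hp]; simp
          have hpos2 : 0 < S.card.choose p.1.card := Nat.choose_pos hcard
          rw [div_mul_div_comm, one_mul]
          refine one_div_le_one_div_of_le (by positivity) ?_
          have := (Nat.mul_le_mul h4 h3).trans (choose_mul_choose_le _ _ _ _)
          exact_mod_cast this
      _ = 1 / ((m.choose a : ℝ) ^ 2) * ∑ r ∈ Finset.range (S.card + 1),
          (1 / ((S.card.choose r : ℝ) ^ 2)) := by
          rw [Multiset.sum_map_mul_left, sum_antidiagonal_card S fun r =>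
            1 / ((S.card.choose r : ℝ) ^ 3)]
          congr 1
          refine Finset.sum_congr rfl fun r hr => ?_
          have hr := Finset.mem_range.1 hr
          have : (S.card.choose r : ℝ) ≠ 0 := by
            exact_mod_cast (Nat.choose_pos (show r ≤ S.card by omega)).ne'
          field_simp
      _ ≤ _ := by
          gcongr
          exact sum_inv_choose_sq_le _
  refine (Finset.sum_le_sum h1).trans ?_
  rw [← Finset.sum_mul]
  linarith [sum_inv_choose_sq_le m]

/-! ### Normalized numbers -/

/-- The normalized numbers. -/
def cnum (S : Multiset ℕ) : ℝ := 4 ^ (S.sum + 1) * (psi S : ℝ) / ((mwt S - 1)! : ℝ)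

/-- The factorial in the normalization absorbs the factor `mwt S` of the dilaton equation. -/
theorem cnum_zero_cons {S : Multiset ℕ} (hS : S ≠ 0) : cnum (0 ::ₘ S) = cnum S := by
  rw [cnum, cnum, psi_zero_cons S hS, mwt_cons, Multiset.sum_cons]
  obtain ⟨k, hk⟩ := Multiset.exists_mem_of_ne_zero hS
  obtain ⟨R, rfl⟩ := Multiset.exists_cons_of_mem hk
  rw [mwt_cons, show 2 * 0 + 1 + (2 * k + 1 + mwt R) - 1 = (2 * k + mwt R) + 1 by omega,
    show 2 * k + 1 + mwt R - 1 = 2 * k + mwt R by omega, Nat.factorial_succ]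
  push_cast
  have : (2 * (k : ℝ) + mwt R + 1) ≠ 0 := by positivity
  rw [zero_add]
  field_simp
  ring

/-- The recursion has nonnegative coefficients, and every number on its right-hand side has smaller
weight. -/
theorem psi_nonneg (S : Multiset ℕ) : 0 ≤ psi S := by
  induction h : mwt S using Nat.strong_induction_on generalizing S with
  | _ N ih =>
    subst h
    rcases S.empty_or_exists_mem with rfl | ⟨k, hk⟩
    · simp [psi]
    · obtain ⟨R, rfl⟩ := Multiset.exists_cons_of_mem hk
      rcases k with _ | m
      · rcases eq_or_ne R 0 with rfl | hR
        · have := psi_singleton 0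
          rw [beta_one] at this
          rw [Multiset.cons_zero, this]
          simp [evalBase]
        · rw [psi_zero_cons R hR]
          have := ih (mwt R) (by rw [mwt_cons]; omega) R rfl
          positivity
      · have h := psi_succ_cons m R
        have h1 : 0 ≤ (R.map fun d : ℕ => (2 * d + 1 : ℚ) *
            psi ((d + (m + 1)) ::ₘ R.erase d)).sum := by
          refine Multiset.sum_nonneg fun x hx => ?_
          obtain ⟨d, hd, rfl⟩ := Multiset.mem_map.1 hx
          refine mul_nonneg (by positivity) (ih _ ?_ _ rfl)
          obtain ⟨T, rfl⟩ := Multiset.exists_cons_of_mem hd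
          rw [Multiset.erase_cons_head]
          simp only [mwt_cons]
          omega
        have h2 : 0 ≤ ∑ a ∈ Finset.range (m + 1), (psi (a ::ₘ (m - a) ::ₘ R) +
            (R.antidiagonal.map fun p => psi (a ::ₘ p.1) * psi ((m - a) ::ₘ p.2)).sum) := by
          refine Finset.sum_nonneg fun a ha => ?_
          have ha := Finset.mem_range.1 ha
          refine add_nonneg (ih _ ?_ _ rfl) (Multiset.sum_nonneg fun x hx => ?_)
          · simp only [mwt_cons]; omega
          · obtain ⟨p, hp, rfl⟩ := Multiset.mem_map.1 hx
            have hp := Multiset.mem_antidiagonal.1 hp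
            have : mwt R = mwt p.1 + mwt p.2 := by rw [← hp, mwt_add]
            refine mul_nonneg (ih _ ?_ _ rfl) (ih _ ?_ _ rfl)
            · simp only [mwt_cons]; omega
            · simp only [mwt_cons]; omega
        linarith

theorem cnum_nonneg (S : Multiset ℕ) : 0 ≤ cnum S := by
  have : (0 : ℝ) ≤ psi S := by exact_mod_cast psi_nonneg S
  unfold cnum
  positivity

/-- The point of this form is that `∑ (2d + 1) + 2 (m + 1)`, the total weight of the linear terms,
equals the factor on the left. The factorials turn the products into terms damped by reciprocal
binomials. -/
theorem cnum_succ_cons (m : ℕ) (S : Multiset ℕ) :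
    (2 * (m + 1) + mwt S : ℝ) * cnum ((m + 1) ::ₘ S) =
      (S.map fun d : ℕ => (2 * d + 1 : ℝ) * cnum ((d + (m + 1)) ::ₘ S.erase d)).sum +
      2 * ∑ a ∈ Finset.range (m + 1), cnum (a ::ₘ (m - a) ::ₘ S) +
      (∑ a ∈ Finset.range (m + 1), (S.antidiagonal.map fun p =>
        cnum (a ::ₘ p.1) * cnum ((m - a) ::ₘ p.2) *
          (1 / ((2 * m + mwt S).choose (2 * a + mwt p.1) : ℝ))).sum) /
        (2 * (2 * m + 1 + mwt S)) := by
  set M := 2 * m + mwt S with hM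
  set Q : ℝ := 4 ^ (m + S.sum + 2) with hQ
  have e1 : cnum ((m + 1) ::ₘ S) = Q * psi ((m + 1) ::ₘ S) / ((M + 2)! : ℝ) := by
    rw [cnum, mwt_cons, Multiset.sum_cons, show 2 * (m + 1) + 1 + mwt S - 1 = M + 2 by omega,
      show m + 1 + S.sum + 1 = m + S.sum + 2 by ring]
  have e2 : (S.map fun d : ℕ => (2 * d + 1 : ℝ) * cnum ((d + (m + 1)) ::ₘ S.erase d)).sum =
      Q / ((M + 1)! : ℝ) * (((S.map fun d : ℕ => (2 * d + 1 : ℚ) *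
        psi ((d + (m + 1)) ::ₘ S.erase d)).sum : ℚ) : ℝ) := by
    rw [Rat.cast_multiset_sum, Multiset.map_map, ← Multiset.sum_map_mul_left]
    refine congrArg Multiset.sum (Multiset.map_congr rfl fun d hd => ?_)
    obtain ⟨T, hT⟩ := Multiset.exists_cons_of_mem hd
    rw [Function.comp_apply, cnum, mwt_cons, Multiset.sum_cons]
    have h1 : 2 * (d + (m + 1)) + 1 + mwt (S.erase d) - 1 = M + 1 := by
      rw [hM, hT, Multiset.erase_cons_head, mwt_cons]; omega
    have h2 : d + (m + 1) + (S.erase d).sum + 1 = m + S.sum + 2 := by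
      rw [hT, Multiset.erase_cons_head, Multiset.sum_cons]; omega
    rw [h1, h2]
    push_cast
    ring
  have e3 : ∀ a ∈ Finset.range (m + 1), cnum (a ::ₘ (m - a) ::ₘ S) =
      Q / ((M + 1)! : ℝ) * ((1 / 4) * (psi (a ::ₘ (m - a) ::ₘ S) : ℝ)) := by
    intro a ha
    have ha := Finset.mem_range.1 ha
    rw [cnum, mwt_cons, mwt_cons, Multiset.sum_cons, Multiset.sum_cons,
      show 2 * a + 1 + (2 * (m - a) + 1 + mwt S) - 1 = M + 1 by omega,
      show a + (m - a + S.sum) + 1 = m + S.sum + 1 by omega, hQ]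
    ring
  have e4 : ∀ a ∈ Finset.range (m + 1), (S.antidiagonal.map fun p =>
        cnum (a ::ₘ p.1) * cnum ((m - a) ::ₘ p.2) *
          (1 / (M.choose (2 * a + mwt p.1) : ℝ))).sum =
      Q / (M ! : ℝ) * (((S.antidiagonal.map fun p =>
        psi (a ::ₘ p.1) * psi ((m - a) ::ₘ p.2)).sum : ℚ) : ℝ) := by
    intro a ha
    have ha := Finset.mem_range.1 ha
    rw [Rat.cast_multiset_sum, Multiset.map_map, ← Multiset.sum_map_mul_left]
    refine congrArg Multiset.sum (Multiset.map_congr rfl fun p hp => ?_)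
    have hp := Multiset.mem_antidiagonal.1 hp
    have hw : mwt S = mwt p.1 + mwt p.2 := by rw [← hp, mwt_add]
    have hs : S.sum = p.1.sum + p.2.sum := by rw [← hp, Multiset.sum_add]
    have hc := Nat.choose_mul_factorial_mul_factorial (show 2 * a + mwt p.1 ≤ M by omega)
    rw [show M - (2 * a + mwt p.1) = 2 * (m - a) + mwt p.2 by omega] at hc
    have hc' : (M ! : ℝ) = (M.choose (2 * a + mwt p.1) : ℝ) * ((2 * a + mwt p.1)! : ℝ) *
        ((2 * (m - a) + mwt p.2)! : ℝ) := by exact_mod_cast hc.symm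
    have hQ' : Q = 4 ^ (a + p.1.sum + 1) * 4 ^ (m - a + p.2.sum + 1) := by
      rw [hQ, ← pow_add]; congr 1; omega
    rw [Function.comp_apply, cnum, cnum, mwt_cons, mwt_cons, Multiset.sum_cons, Multiset.sum_cons,
      show 2 * a + 1 + mwt p.1 - 1 = 2 * a + mwt p.1 by omega,
      show 2 * (m - a) + 1 + mwt p.2 - 1 = 2 * (m - a) + mwt p.2 by omega, hc', hQ']
    push_cast
    ring
  have h := congrArg (fun q : ℚ => (q : ℝ)) (psi_succ_cons m S)
  simp only [Rat.cast_add, Rat.cast_mul, Rat.cast_sum, Rat.cast_ofNat] at h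
  rw [Finset.sum_add_distrib] at h
  rw [e1, e2, Finset.sum_congr rfl e3, Finset.sum_congr rfl e4, ← Finset.mul_sum, ← Finset.mul_sum,
    ← Finset.mul_sum]
  have f2 : ((M + 2)! : ℝ) = (M + 2) * (M + 1) * (M ! : ℝ) := by
    rw [Nat.factorial_succ, Nat.factorial_succ]; push_cast; ring
  have f1 : ((M + 1)! : ℝ) = (M + 1) * (M ! : ℝ) := by
    rw [Nat.factorial_succ]; push_cast; ring
  have hMc : (M : ℝ) = 2 * m + mwt S := by rw [hM]; push_cast; ring
  have hm1 : (M : ℝ) + 1 ≠ 0 := by positivity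
  have hm2 : (M : ℝ) + 2 ≠ 0 := by positivity
  have hf : (M ! : ℝ) ≠ 0 := by positivity
  rw [f2, f1, show (2 * (m + 1) + mwt S : ℝ) = M + 2 by rw [hMc]; ring,
    show (2 * m + 1 + mwt S : ℝ) = M + 1 by rw [hMc]; ring]
  field_simp
  linear_combination 4 * Q * h

/-! ### Bounds for the normalized numbers -/

theorem abs_multiset_sum_mul_sub_le (S : Multiset ℕ) (w f : ℕ → ℝ) (x U : ℝ) (hw : ∀ d ∈ S, 0 ≤ w d)
    (h : ∀ d ∈ S, |f d - x| ≤ U) :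
    |(S.map fun d => w d * f d).sum - (S.map w).sum * x| ≤ (S.map w).sum * U := by
  induction S using Multiset.induction_on with
  | empty => simp
  | cons a S ih =>
    have h1 := ih (fun d hd => hw d (Multiset.mem_cons_of_mem hd))
      (fun d hd => h d (Multiset.mem_cons_of_mem hd))
    have h2 := h a (Multiset.mem_cons_self a S)
    have h3 := hw a (Multiset.mem_cons_self a S)
    rw [Multiset.map_cons, Multiset.map_cons, Multiset.sum_cons, Multiset.sum_cons]
    rw [abs_le] at h1 h2 ⊢
    constructor <;> nlinarith [h1.1, h1.2, h2.1, h2.2]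

theorem cast_mwt (S : Multiset ℕ) : (mwt S : ℝ) = (S.map fun d : ℕ => (2 * d + 1 : ℝ)).sum := by
  rw [mwt, Nat.cast_multiset_sum, Multiset.map_map]
  simp

/-- The cut-and-join recursion as an approximate averaging property. -/
theorem abs_cnum_succ_cons_sub_le (m : ℕ) {S : Multiset ℕ} (hS : ∀ d ∈ S, 1 ≤ d) (x U V B : ℝ)
    (hU : ∀ d ∈ S, |cnum ((d + (m + 1)) ::ₘ S.erase d) - x| ≤ U)
    (hV : ∀ a ≤ m, |cnum (a ::ₘ (m - a) ::ₘ S) - x| ≤ V)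
    (hB : ∀ T : Multiset ℕ, T ≠ 0 → mwt T + 2 ≤ mwt ((m + 1) ::ₘ S) → cnum T ≤ B) :
    |cnum ((m + 1) ::ₘ S) - x| ≤
      (mwt S * U + 2 * (m + 1) * V) / (2 * (m + 1) + mwt S) +
        9 / 2 * B ^ 2 / ((2 * (m + 1) + mwt S) * (2 * m + 1 + mwt S)) := by
  set M : ℝ := 2 * (m + 1) + mwt S with hM
  have hMpos : 0 < M := by positivity
  have hM1 : (0 : ℝ) < 2 * m + 1 + mwt S := by positivity
  have h := cnum_succ_cons m S
  set E := ∑ a ∈ Finset.range (m + 1), (S.antidiagonal.map fun p =>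
        cnum (a ::ₘ p.1) * cnum ((m - a) ::ₘ p.2) *
          (1 / ((2 * m + mwt S).choose (2 * a + mwt p.1) : ℝ))).sum with hE
  have hE0 : 0 ≤ E := by
    refine Finset.sum_nonneg fun a _ => Multiset.sum_nonneg fun y hy => ?_
    obtain ⟨p, _, rfl⟩ := Multiset.mem_map.1 hy
    have h1 := cnum_nonneg (a ::ₘ p.1)
    have h2 := cnum_nonneg ((m - a) ::ₘ p.2)
    positivity
  -- Both factors of a product have weight at least two below the left-hand side, so `B` bounds
  -- each; `9` is the total of the reciprocal binomials.
  have hEB : E ≤ B ^ 2 * 9 := by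
    refine le_trans ?_ (mul_le_mul_of_nonneg_left (sum_split_le m hS) (sq_nonneg B))
    rw [Finset.mul_sum]
    refine Finset.sum_le_sum fun a ha => ?_
    have ha := Finset.mem_range.1 ha
    rw [← Multiset.sum_map_mul_left]
    refine Multiset.sum_map_le_sum_map _ _ fun p hp => ?_
    have hp := Multiset.mem_antidiagonal.1 hp
    have hw : mwt S = mwt p.1 + mwt p.2 := by rw [← hp, mwt_add]
    have h1 := hB (a ::ₘ p.1) Multiset.cons_ne_zero (by rw [mwt_cons, mwt_cons]; omega)
    have h2 := hB ((m - a) ::ₘ p.2) Multiset.cons_ne_zero (by rw [mwt_cons, mwt_cons]; omega)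
    have h3 := cnum_nonneg (a ::ₘ p.1)
    have h4 := cnum_nonneg ((m - a) ::ₘ p.2)
    rw [sq]
    gcongr
    linarith
  have h1 := abs_multiset_sum_mul_sub_le S (fun d => 2 * d + 1)
    (fun d => cnum ((d + (m + 1)) ::ₘ S.erase d)) x U (fun d _ => by positivity) hU
  rw [← cast_mwt] at h1
  have h2 : |∑ a ∈ Finset.range (m + 1), cnum (a ::ₘ (m - a) ::ₘ S) - (m + 1) * x| ≤
      (m + 1) * V := by
    have e : ∑ a ∈ Finset.range (m + 1), cnum (a ::ₘ (m - a) ::ₘ S) - (m + 1) * x =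
        ∑ a ∈ Finset.range (m + 1), (cnum (a ::ₘ (m - a) ::ₘ S) - x) := by
      rw [Finset.sum_sub_distrib, Finset.sum_const, Finset.card_range, nsmul_eq_mul]
      push_cast; ring
    rw [e]
    refine (Finset.abs_sum_le_sum_abs _ _).trans ((Finset.sum_le_sum fun a ha =>
      hV a (Nat.lt_succ_iff.1 (Finset.mem_range.1 ha))).trans (le_of_eq ?_))
    rw [Finset.sum_const, Finset.card_range, nsmul_eq_mul]
    push_cast; ring
  have h3 : E / (2 * (2 * m + 1 + mwt S)) ≤ 9 / 2 * B ^ 2 / (2 * m + 1 + mwt S) := by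
    rw [div_le_div_iff₀ (by positivity) hM1]
    nlinarith
  have h4 : 0 ≤ E / (2 * (2 * m + 1 + mwt S)) := by positivity
  have e : (mwt S * U + 2 * (m + 1) * V) / M + 9 / 2 * B ^ 2 / (M * (2 * m + 1 + mwt S)) =
      (mwt S * U + 2 * (m + 1) * V + 9 / 2 * B ^ 2 / (2 * m + 1 + mwt S)) / M := by
    field_simp
  rw [e, le_div_iff₀ hMpos, mul_comm, ← abs_of_pos hMpos, ← abs_mul, mul_sub,
    show M * cnum ((m + 1) ::ₘ S) = _ from h]
  rw [abs_le] at h1 h2 ⊢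
  constructor <;> rw [hM] <;> linarith [h1.1, h1.2, h2.1, h2.2]

/-! ### One-part numbers and a uniform bound -/

theorem cnum_singleton_zero : cnum {0} = 1 / 2 := by
  have h := psi_singleton 0
  rw [beta_one] at h
  rw [cnum, h]
  simp [mwt, evalBase]
  norm_num

theorem cnum_singleton_succ (k : ℕ) :
    cnum {k + 1} = (2 * k + 3) ^ 2 / ((2 * k + 2) * (2 * k + 4)) * cnum {k} := by
  rw [cnum, cnum, psi_singleton, psi_singleton, evalBase_beta_succ (k + 1)]
  simp only [← Multiset.cons_zero, mwt_cons, mwt_zero, add_zero,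
    Nat.add_sub_cancel, Multiset.sum_cons, Multiset.sum_zero]
  rw [show 2 * (k + 1) = 2 * k + 1 + 1 by ring, Nat.factorial_succ, Nat.factorial_succ]
  push_cast
  have h1 : (2 * (k : ℝ) + 1) ≠ 0 := by positivity
  have h2 : (2 * (k : ℝ) + 3) ≠ 0 := by positivity
  field_simp
  ring

/-- The ratio of consecutive one-part numbers times the corresponding Wallis factor telescopes. -/
theorem cnum_singleton_mul_W (k : ℕ) :
    cnum {k} * Real.Wallis.W k = (2 * k + 1) / (2 * k + 2) := by
  induction k with
  | zero => rw [cnum_singleton_zero]; simp [Real.Wallis.W]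
  | succ k ih =>
    rw [cnum_singleton_succ, Real.Wallis.W_succ]
    have e : ∀ p q : ℝ, p * cnum {k} * (Real.Wallis.W k * q) =
      p * q * (cnum {k} * Real.Wallis.W k) := fun p q => by ring
    rw [e, ih]
    push_cast
    field_simp
    ring

open Topology in
theorem tendsto_cnum_singleton :
    Tendsto (fun k : ℕ => cnum {k}) atTop (𝓝 (2 / Real.pi)) := by
  have h1 : Tendsto (fun k : ℕ => (1 - 1 / ((k : ℝ) + 1) * (1 / 2))) atTop
      (𝓝 (1 - 0 * (1 / 2))) :=
    (tendsto_const_nhds (x := (1 : ℝ))).sub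
      (tendsto_one_div_add_atTop_nhds_zero_nat.mul_const (1 / 2))
  have h2 := h1.div Real.Wallis.tendsto_W_nhds_pi_div_two (by positivity)
  have e : (1 - 0 * (1 / 2)) / (Real.pi / 2) = 2 / Real.pi := by
    have := Real.pi_ne_zero
    field_simp
    norm_num
  rw [e] at h2
  refine h2.congr fun k => ?_
  have hW := (Real.Wallis.W_pos k).ne'
  rw [Pi.div_apply, div_eq_iff hW, cnum_singleton_mul_W]
  have : (k : ℝ) + 1 ≠ 0 := by positivity
  field_simp
  ring

/-- An increasing majorant for the normalized numbers. -/
def majorant (N : ℝ) : ℝ := 18 * (N - 1) / (5 * (N - 1) + 81)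

theorem majorant_mono {x y : ℝ} (hx : 1 ≤ x) (h : x ≤ y) : majorant x ≤ majorant y := by
  unfold majorant
  rw [div_le_div_iff₀ (by linarith) (by linarith)]
  nlinarith

/-- The reciprocal of `majorant N` is `5/18 + 9 / (2 (N - 1))`, and it drops by exactly `9/2 / ((N -
1) (N - 2))` at each step. The increment of `majorant` is therefore this quantity times a product of
two consecutive values, which exceeds the square of the smaller one. -/
theorem majorant_step {N : ℝ} (hN : 3 ≤ N) :
    majorant (N - 1) + 9 / 2 * majorant (N - 1) ^ 2 / ((N - 1) * (N - 2)) ≤ majorant N := by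
  unfold majorant
  have h1 : 0 < 5 * (N - 1) + 81 := by linarith
  have h2 : 0 < 5 * (N - 1 - 1) + 81 := by linarith
  have h3 : 0 < N - 1 := by linarith
  have h4 : 0 < N - 2 := by linarith
  have e : 18 * (N - 1 - 1) / (5 * (N - 1 - 1) + 81) + 9 / 2 *
      (18 * (N - 1 - 1) / (5 * (N - 1 - 1) + 81)) ^ 2 / ((N - 1) * (N - 2)) =
      18 * (N - 2) * ((N - 1) * (5 * (N - 2) + 81) + 81) /
        ((5 * (N - 1 - 1) + 81) ^ 2 * (N - 1)) := by
    rw [show N - 1 - 1 = N - 2 by ring] at h2 ⊢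
    field_simp
    ring
  rw [e, div_le_div_iff₀ (by positivity) h1]
  nlinarith [mul_pos h3 h4, mul_pos (mul_pos h3 h4) h2]

/-- Induction on the weight: zeros are dropped freely, and otherwise the averaging property bounds
the number by the previous majorant plus its quadratic error. -/
theorem cnum_le_majorant {S : Multiset ℕ} (hS : S ≠ 0) : cnum S ≤ majorant (max 4 (mwt S)) := by
  induction h : mwt S using Nat.strong_induction_on generalizing S with
  | _ N ih =>
    by_cases h0 : 0 ∈ S
    · obtain ⟨R, rfl⟩ := Multiset.exists_cons_of_mem h0
      rcases eq_or_ne R 0 with rfl | hR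
      · have hm : majorant 4 ≤ majorant (max 4 N) := majorant_mono (by norm_num) (le_max_left _ _)
        rw [Multiset.cons_zero, cnum_singleton_zero]
        refine le_trans ?_ hm
        norm_num [majorant]
      · rw [cnum_zero_cons hR]
        rw [mwt_cons] at h
        refine (ih (mwt R) (by omega) hR rfl).trans (majorant_mono ?_ ?_)
        · exact le_trans (by norm_num) (le_max_left _ _)
        · refine max_le_max le_rfl ?_
          exact_mod_cast (by omega : mwt R ≤ N)
    · obtain ⟨k, hk⟩ := Multiset.exists_mem_of_ne_zero hS
      have hk0 : k ≠ 0 := fun h => h0 (h ▸ hk)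
      obtain ⟨m, rfl⟩ := Nat.exists_eq_succ_of_ne_zero hk0
      obtain ⟨R, rfl⟩ := Multiset.exists_cons_of_mem hk
      have hR : ∀ d ∈ R, 1 ≤ d := fun d hd =>
        Nat.one_le_iff_ne_zero.2 fun h => h0 (h ▸ Multiset.mem_cons_of_mem hd)
      rw [mwt_cons] at h
      -- Below weight `5` the only nonempty zero-free multiset is `{1}`. The constants in `majorant`
      -- make `majorant 4 = 9/16 = cnum {1}`.
      rcases Nat.lt_or_ge N 5 with hN | hN
      · have hR0 : R = 0 := by
          by_contra hne
          obtain ⟨d, hd⟩ := Multiset.exists_mem_of_ne_zero hne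
          have := hR d hd
          obtain ⟨T, rfl⟩ := Multiset.exists_cons_of_mem hd
          rw [mwt_cons] at h
          omega
        have hm0 : m = 0 := by omega
        subst hR0 hm0
        have hm : majorant 4 ≤ majorant (max 4 N) := majorant_mono (by norm_num) (le_max_left _ _)
        rw [Multiset.cons_zero, Nat.succ_eq_add_one, cnum_singleton_succ, cnum_singleton_zero]
        refine le_trans ?_ hm
        norm_num [majorant]
      · have hN' : (5 : ℝ) ≤ N := by exact_mod_cast hN
        have hNc : (N : ℝ) = 2 * (m + 1) + 1 + mwt R := by rw [← h]; push_cast; ring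
        have hmaj : ∀ T : Multiset ℕ, T ≠ 0 → mwt T + 1 ≤ N → cnum T ≤ majorant (N - 1) := by
          intro T hT hTN
          refine (ih (mwt T) (by omega) hT rfl).trans (majorant_mono ?_ ?_)
          · exact le_trans (by norm_num) (le_max_left _ _)
          · have : (mwt T : ℝ) + 1 ≤ N := by exact_mod_cast hTN
            exact max_le (by linarith) (by linarith)
        have key := abs_cnum_succ_cons_sub_le m hR 0 (majorant (N - 1)) (majorant (N - 1))
          (majorant (N - 1)) (fun d hd => by
            rw [sub_zero, abs_of_nonneg (cnum_nonneg _)]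
            refine hmaj _ Multiset.cons_ne_zero ?_
            obtain ⟨T, rfl⟩ := Multiset.exists_cons_of_mem hd
            rw [Multiset.erase_cons_head, mwt_cons]
            rw [mwt_cons] at h
            omega) (fun a ha => by
            rw [sub_zero, abs_of_nonneg (cnum_nonneg _)]
            refine hmaj _ Multiset.cons_ne_zero ?_
            rw [mwt_cons, mwt_cons]
            omega) (fun T hT hTN => by
            refine hmaj T hT ?_
            rw [mwt_cons] at hTN
            omega)
        rw [sub_zero, abs_of_nonneg (cnum_nonneg _)] at key
        have hstep := majorant_step (N := N) (by linarith)
        rw [max_eq_right (by linarith)]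
        refine key.trans (le_trans (le_of_eq ?_) hstep)
        rw [show (2 * (m + 1) + mwt R : ℝ) = N - 1 by rw [hNc]; ring,
          show (2 * m + 1 + mwt R : ℝ) = N - 2 by rw [hNc]; ring,
          show (mwt R : ℝ) * majorant (N - 1) + 2 * (m + 1) * majorant (N - 1) =
            (N - 1) * majorant (N - 1) by rw [hNc]; ring,
          mul_div_cancel_left₀ _ (by linarith : (N : ℝ) - 1 ≠ 0)]

/-- The majorant stays below its limit `18/5`. -/
theorem cnum_le_four {S : Multiset ℕ} (hS : S ≠ 0) : cnum S ≤ 4 := by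
  refine (cnum_le_majorant hS).trans ?_
  have : (4 : ℝ) ≤ max 4 (mwt S : ℝ) := le_max_left _ _
  unfold majorant
  rw [div_le_iff₀ (by linarith)]
  linarith

/-! ### Convergence of the normalized numbers -/

theorem cnum_replicate_zero_add (z : ℕ) {T : Multiset ℕ} (hT : T ≠ 0) :
    cnum (Multiset.replicate z 0 + T) = cnum T := by
  induction z with
  | zero => simp
  | succ z ih =>
    rw [Multiset.replicate_succ, Multiset.cons_add, cnum_zero_cons, ih]
    intro h
    have := congrArg Multiset.card h
    rw [Multiset.card_add, Multiset.card_zero] at this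
    exact hT (Multiset.card_eq_zero.1 (by omega))

/-- Removing the zeros of a multiset does not change its normalized number. -/
theorem exists_zero_free (S : Multiset ℕ) : ∃ T : Multiset ℕ, (∀ d ∈ T, 1 ≤ d) ∧ T.sum = S.sum ∧
    T.card ≤ S.card ∧ mwt T ≤ mwt S ∧ (T ≠ 0 → cnum T = cnum S) := by
  have h := Multiset.filter_add_not (· = 0) S
  rw [Multiset.filter_eq'] at h
  set T := S.filter fun d => ¬ d = 0 with hT
  refine ⟨T, fun d hd => Nat.one_le_iff_ne_zero.2 (Multiset.mem_filter.1 hd).2, ?_, ?_, ?_, ?_⟩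
  · rw [← h]; simp
  · rw [← h]; simp
  · rw [← h, mwt_add]; omega
  · intro hne
    rw [← h, cnum_replicate_zero_add _ hne]

/-- The cost of having `n` parts. -/
def partCost (n : ℕ) : ℝ := if n ≤ 1 then 0 else n

theorem partCost_nonneg (n : ℕ) : 0 ≤ partCost n := by
  unfold partCost; split_ifs <;> positivity

theorem partCost_mono {n k : ℕ} (h : n ≤ k) : partCost n ≤ partCost k := by
  unfold partCost
  split_ifs
  · exact le_rfl
  · positivity
  · omega
  · exact_mod_cast h

/-- With probability `1 / n` of a cut, the expected cost does not grow even if a cut also costs a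
factor `5/4`. Equality at `n = 3` shows that `5/4` is the largest possible factor; at `n = 2` the
zero cost of a single part is needed. -/
theorem partCost_step {n : ℕ} (hn : 2 ≤ n) :
    (n - 1 : ℝ) * partCost (n - 1) + 5 / 4 * partCost (n + 1) ≤ n * partCost n := by
  unfold partCost
  rw [if_neg (show ¬ n + 1 ≤ 1 by omega), if_neg (show ¬ n ≤ 1 by omega)]
  rcases hn.eq_or_lt with rfl | hn
  · norm_num
  · rw [if_neg (by omega), Nat.cast_sub (by omega)]
    have : (3 : ℝ) ≤ n := by exact_mod_cast hn
    push_cast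
    nlinarith

/-- Cutting is the costlier outcome, so a cut probability below `1 / n` only improves on
`partCost_step`. -/
theorem partCost_average {n : ℕ} (hn : 2 ≤ n) {p q : ℝ} (hp : 0 ≤ p) (hpq : n * p ≤ p + q) :
    q * partCost (n - 1) + p * (5 / 4 * partCost (n + 1)) ≤ (p + q) * partCost n := by
  have hn0 : (0 : ℝ) < n := by positivity
  have h1 := partCost_step hn
  have h2 : partCost (n - 1) ≤ 5 / 4 * partCost (n + 1) := by
    have := partCost_mono (show n - 1 ≤ n + 1 by omega)
    have := partCost_nonneg (n + 1)
    linarith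
  have h3 : (p + q - n * p) * (5 / 4 * partCost (n + 1) - partCost (n - 1)) ≥ 0 :=
    mul_nonneg (by linarith) (by linarith)
  have hq : 0 ≤ p + q := le_trans (by positivity) hpq
  have h4 := mul_le_mul_of_nonneg_left h1 hq
  refine le_of_mul_le_mul_left ?_ hn0
  nlinarith

/-- Uniform approximation of the normalized numbers without zeros by the limit of the numbers
attached to singletons. -/
theorem abs_cnum_sub_le {L ε : ℝ} {G : ℕ} (hG : 1 ≤ G) (hL : ∀ S ≠ 0, |cnum S - L| ≤ 4)
    (hε : 0 ≤ ε) (h1 : ∀ g : ℕ, G ≤ g → |cnum {g} - L| ≤ ε) {S : Multiset ℕ} (hS : ∀ d ∈ S, 1 ≤ d)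
    (hne : S ≠ 0) (hSG : G ≤ S.sum) :
    |cnum S - L| ≤ ε + partCost S.card * (4 * (4 / 5) ^ (S.sum - G)) +
      72 * (1 / (2 * G) - 1 / (mwt S - 1)) := by
  -- The bound is a potential for the averaging: merging keeps the sum and removes a part, cutting
  -- lowers the sum by one and adds at most one part, and the last term collects the quadratic
  -- errors.
  induction h : mwt S using Nat.strong_induction_on generalizing S with
  | _ N ih =>
    have hG' : (1 : ℝ) ≤ G := by exact_mod_cast hG
    have hN : N = 2 * S.sum + S.card := by rw [← h, mwt_eq]
    have hcard : 0 < S.card := Multiset.card_pos.2 hne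
    -- One-part multisets end the process: their cost is zero and `h1` applies.
    rcases Nat.lt_or_ge S.card 2 with hc | hc
    · obtain ⟨g, rfl⟩ := Multiset.card_eq_one.1 (show S.card = 1 by omega)
      rw [Multiset.sum_singleton] at hSG hN
      have h2 := h1 g hSG
      have h3 : partCost (Multiset.card ({g} : Multiset ℕ)) = 0 := by simp [partCost]
      have hNc : (N : ℝ) - 1 = 2 * g := by rw [hN]; simp
      have h4 : (1 : ℝ) / (N - 1) ≤ 1 / (2 * G) := by
        rw [hNc]
        refine one_div_le_one_div_of_le (by positivity) ?_
        have : (G : ℝ) ≤ g := by exact_mod_cast hSG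
        linarith
      rw [h3]
      linarith
    -- For the smallest of `n` parts, `n * k ≤ S.sum`, so the share `2 k / (N - 1)` of the cut terms
    -- is at most `1 / n`.
    · obtain ⟨k, hk, hmin⟩ : ∃ k ∈ S, ∀ d ∈ S, k ≤ d := by
        obtain ⟨k, hk, hmin⟩ := S.toFinset.exists_min_image id
          (Multiset.toFinset_nonempty.2 hne)
        exact ⟨k, Multiset.mem_toFinset.1 hk, fun d hd => hmin d (Multiset.mem_toFinset.2 hd)⟩
      obtain ⟨m, rfl⟩ : ∃ m, k = m + 1 := ⟨k - 1, by have := hS k hk; omega⟩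
      have hcm : S.card * (m + 1) ≤ S.sum := by
        simpa using Multiset.card_nsmul_le_sum hmin
      obtain ⟨R, rfl⟩ := Multiset.exists_cons_of_mem hk
      have hR : ∀ d ∈ R, 1 ≤ d := fun d hd => hS d (Multiset.mem_cons_of_mem hd)
      have hRne : R ≠ 0 := by
        rintro rfl
        simp at hc
      have hRc : 0 < R.card := Multiset.card_pos.2 hRne
      rw [Multiset.sum_cons] at hSG hN hcm
      rw [Multiset.card_cons] at hN hc hcm
      rw [Multiset.sum_cons, Multiset.card_cons]
      rw [mwt_cons] at h
      set n := R.card + 1 with hn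
      set σ := m + 1 + R.sum with hσ
      set q : ℝ := 4 * (4 / 5) ^ (σ - G) with hq
      have hq0 : 0 ≤ q := by positivity
      have hNc : (N : ℝ) = 2 * (m + 1) + 1 + mwt R := by rw [← h]; push_cast; ring
      have hNσ : (N : ℝ) = 2 * σ + n := by rw [hN]; push_cast; ring
      have hσG : (G : ℝ) ≤ σ := by exact_mod_cast hSG
      have hn2 : (2 : ℝ) ≤ n := by exact_mod_cast hc
      set E : ℝ := 72 * (1 / (2 * G) - 1 / (N - 1 - 1)) with hE
      have hE0 : 0 ≤ E := by
        have : (1 : ℝ) / (N - 1 - 1) ≤ 1 / (2 * G) :=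
          one_div_le_one_div_of_le (by positivity) (by linarith)
        rw [hE]; linarith
      have hE1 : ∀ T : Multiset ℕ, T ≠ 0 → G ≤ T.sum → mwt T + 1 ≤ N →
          72 * (1 / (2 * (G : ℝ)) - 1 / (mwt T - 1)) ≤ E := by
        intro T hT hTG hTN
        have hTw := mwt_eq T
        have hTc := Multiset.card_pos.2 hT
        have h3 : (mwt T : ℝ) + 1 ≤ N := by exact_mod_cast hTN
        have h4 : (2 : ℝ) ≤ mwt T := by exact_mod_cast (by omega : 2 ≤ mwt T)
        have : (1 : ℝ) / (N - 1 - 1) ≤ 1 / (mwt T - 1) :=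
          one_div_le_one_div_of_le (by linarith) (by linarith)
        rw [hE]; linarith
      have hU : ∀ d ∈ R, |cnum ((d + (m + 1)) ::ₘ R.erase d) - L| ≤
          ε + partCost (n - 1) * q + E := by
        intro d hd
        obtain ⟨T, rfl⟩ := Multiset.exists_cons_of_mem hd
        rw [Multiset.erase_cons_head]
        have hs : ((d + (m + 1)) ::ₘ T).sum = σ := by
          rw [hσ, Multiset.sum_cons, Multiset.sum_cons]; ring
        have hw : mwt ((d + (m + 1)) ::ₘ T) + 1 ≤ N := by
          rw [mwt_cons]; rw [mwt_cons] at h; omega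
        have hcd : ((d + (m + 1)) ::ₘ T).card = n - 1 := by
          rw [hn, Multiset.card_cons, Multiset.card_cons]; rfl
        have h3 := ih _ (by omega) (S := (d + (m + 1)) ::ₘ T) (fun e he => by
          rcases Multiset.mem_cons.1 he with rfl | he
          · omega
          · exact hR e (Multiset.mem_cons_of_mem he)) Multiset.cons_ne_zero (by rw [hs]; exact hSG)
          rfl
        have h4 := hE1 _ Multiset.cons_ne_zero (by rw [hs]; exact hSG) hw
        rw [hs, hcd] at h3
        linarith
      have hV : ∀ a ≤ m, |cnum (a ::ₘ (m - a) ::ₘ R) - L| ≤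
          ε + 5 / 4 * partCost (n + 1) * q + E := by
        intro a ha
        have hpc : (3 : ℝ) ≤ partCost (n + 1) := by
          rw [partCost, if_neg (by omega)]; push_cast; linarith
        -- If a cut takes the sum below `G`, the trivial bound `4` suffices, because the exponent is
        -- then zero and the cost term already exceeds `4`. Otherwise the zeros a cut may create are
        -- removed before induction.
        rcases Nat.lt_or_ge (σ - 1) G with hlt | hge
        · have hq4 : q = 4 := by
            rw [hq, show σ - G = 0 by omega]; norm_num
          have h3 := hL (a ::ₘ (m - a) ::ₘ R) Multiset.cons_ne_zero
          rw [hq4]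
          linarith
        · obtain ⟨T, hT1, hT2, hT3, hT4, hT5⟩ := exists_zero_free (a ::ₘ (m - a) ::ₘ R)
          have hs : T.sum = σ - 1 := by
            rw [hT2, Multiset.sum_cons, Multiset.sum_cons]; omega
          have hTne : T ≠ 0 := by
            rintro rfl
            rw [Multiset.sum_zero] at hs
            omega
          have hw : mwt T + 1 ≤ N := by
            rw [mwt_cons, mwt_cons] at hT4; omega
          have h3 := ih _ (by omega) hT1 hTne (by rw [hs]; exact hge) rfl
          have h4 := hE1 T hTne (by rw [hs]; exact hge) hw
          have hcd : partCost T.card ≤ partCost (n + 1) := by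
            refine partCost_mono (hT3.trans (le_of_eq ?_))
            rw [Multiset.card_cons, Multiset.card_cons]
          have hq' : 4 * (4 / 5 : ℝ) ^ (T.sum - G) = 5 / 4 * q := by
            rw [hq, hs, show σ - G = σ - 1 - G + 1 by omega, pow_succ]; ring
          rw [hT5 hTne, hq'] at h3
          have h5 := mul_le_mul_of_nonneg_right hcd (show 0 ≤ 5 / 4 * q by positivity)
          linarith
      have key := abs_cnum_succ_cons_sub_le m hR L _ _ 4 hU hV fun T hT _ => cnum_le_four hT
      refine key.trans ?_
      have hp : (0 : ℝ) ≤ 2 * (m + 1) := by positivity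
      have hcm' : (n : ℝ) * (m + 1) ≤ σ := by exact_mod_cast hcm
      have h6 := partCost_average hc hp (q := mwt R) (by linarith)
      have hM : (2 * (m + 1) + mwt R : ℝ) = N - 1 := by rw [hNc]; ring
      have hM1 : (2 * m + 1 + mwt R : ℝ) = N - 2 := by rw [hNc]; ring
      rw [hM] at h6
      rw [hM, hM1]
      have hN1 : (0 : ℝ) < N - 1 := by linarith
      have hN2 : (0 : ℝ) < N - 2 := by linarith
      -- Here `72 = 9/2 * 4²`, and the error telescopes since `1 / (N - 2) - 1 / (N - 1) = 1 / ((N -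
      -- 1) (N - 2))`.
      have e1 : 72 * (1 / (2 * G) - 1 / ((N : ℝ) - 1)) = E + 9 / 2 * 4 ^ 2 / ((N - 1) * (N - 2)) := by
        rw [hE, show (N : ℝ) - 1 - 1 = N - 2 by ring]
        field_simp
        ring
      rw [e1, ← add_assoc]
      gcongr
      rw [div_le_iff₀ hN1]
      have h7 := mul_le_mul_of_nonneg_right h6 hq0
      have e2 : (mwt R : ℝ) * (ε + E) + 2 * (m + 1) * (ε + E) = (N - 1) * (ε + E) := by
        rw [← hM]; ring
      linarith

-- For `n` equal parts the sum is at least `n`, so the cost term is `O(n (4/5)ⁿ)` once `G` is fixed.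
-- The remaining errors are made small by choosing `G` first.
open Topology in
theorem tendsto_cnum_replicate {d : ℕ} (hd : 1 ≤ d) :
    Tendsto (fun n => cnum (Multiset.replicate n d)) atTop (𝓝 (2 / Real.pi)) := by
  rw [Metric.tendsto_atTop]
  intro η hη
  obtain ⟨G₁, hG₁⟩ := (Metric.tendsto_atTop.1 tendsto_cnum_singleton) (η / 4) (by positivity)
  -- This makes `72 / (2 G)` smaller than `η / 4`.
  obtain ⟨G₂, hG₂⟩ := exists_nat_gt (144 / η)
  set G := max (max G₁ G₂) 1 with hG
  have hG1 : 1 ≤ G := le_max_right _ _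
  have hGr : 144 / η < G := hG₂.trans_le (by
    exact_mod_cast (le_max_right G₁ G₂).trans (le_max_left _ _))
  have hG1' : (1 : ℝ) ≤ G := by exact_mod_cast hG1
  have hlim : Tendsto (fun n : ℕ => (n : ℝ) * (4 / 5) ^ n * (4 * (5 / 4) ^ G)) atTop
      (𝓝 (0 * (4 * (5 / 4) ^ G))) :=
    (tendsto_self_mul_const_pow_of_lt_one (by norm_num) (by norm_num)).mul_const _
  rw [zero_mul] at hlim
  obtain ⟨n₀, hn₀⟩ := (Metric.tendsto_atTop.1 hlim) (η / 4) (by positivity)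
  have hL : ∀ S : Multiset ℕ, S ≠ 0 → |cnum S - 2 / Real.pi| ≤ 4 := by
    intro S hS
    have h1 := cnum_le_four hS
    have h2 := cnum_nonneg S
    have h3 : 0 < 2 / Real.pi := by positivity
    have h4 : 2 / Real.pi ≤ 1 := by
      rw [div_le_one Real.pi_pos]
      exact Real.two_le_pi
    rw [abs_le]
    constructor <;> linarith
  refine ⟨max n₀ G, fun n hn => ?_⟩
  have hnG : G ≤ n := (le_max_right _ _).trans hn
  have hsum : (Multiset.replicate n d).sum = n * d := by simp
  have hnd : n ≤ n * d := Nat.le_mul_of_pos_right n hd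
  have key := abs_cnum_sub_le (L := 2 / Real.pi) (ε := η / 4) hG1 hL (by positivity) (fun g hg =>
      (hG₁ g (((le_max_left _ _).trans (le_max_left _ _)).trans hg)).le)
    (S := Multiset.replicate n d) (fun e he => by rw [Multiset.eq_of_mem_replicate he]; exact hd)
    (by
      intro h
      have := congrArg Multiset.card h
      rw [Multiset.card_replicate, Multiset.card_zero] at this
      omega)
    (by rw [hsum]; omega)
  rw [hsum, Multiset.card_replicate] at key
  have hw : (1 : ℝ) ≤ mwt (Multiset.replicate n d) := by
    have := mwt_eq (Multiset.replicate n d)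
    rw [Multiset.card_replicate] at this
    exact_mod_cast (by omega : 1 ≤ mwt (Multiset.replicate n d))
  have h2 : (0 : ℝ) ≤ 1 / (mwt (Multiset.replicate n d) - 1) :=
    one_div_nonneg.2 (by linarith)
  have h3 : 72 * (1 / (2 * (G : ℝ))) < η / 4 := by
    rw [div_lt_iff₀ hη] at hGr
    rw [mul_one_div, div_lt_div_iff₀ (by positivity) (by norm_num)]
    linarith
  have h4 := hn₀ n ((le_max_left _ _).trans hn)
  rw [Real.dist_eq, sub_zero, abs_of_nonneg (by positivity)] at h4
  have h5 : partCost n ≤ n := by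
    unfold partCost; split_ifs
    · positivity
    · exact le_rfl
  have h6 : (4 / 5 : ℝ) ^ (n * d - G) ≤ (4 / 5) ^ n * (5 / 4) ^ G := by
    have e : (4 / 5 : ℝ) ^ n * (5 / 4) ^ G = (4 / 5) ^ (n - G) := by
      obtain ⟨j, rfl⟩ := Nat.exists_eq_add_of_le hnG
      rw [Nat.add_sub_cancel_left, pow_add, mul_right_comm, ← mul_pow]
      norm_num
    rw [e]
    exact pow_le_pow_of_le_one (by norm_num) (by norm_num) (by omega)
  have h7 : partCost n * (4 * (4 / 5) ^ (n * d - G)) ≤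
      (n : ℝ) * (4 / 5) ^ n * (4 * (5 / 4) ^ G) := by
    calc partCost n * (4 * (4 / 5) ^ (n * d - G))
        ≤ n * (4 * ((4 / 5) ^ n * (5 / 4) ^ G)) := by
          have := partCost_nonneg n
          gcongr
      _ = _ := by ring
  rw [Real.dist_eq]
  linarith

/-! ### The hierarchy on power series in `X⁻¹` -/

/-- The derivation `d/dX = -w² d/dw` on power series in `w = X⁻¹`. -/
def pd (f : PowerSeries ℂ) : PowerSeries ℂ := -(PowerSeries.X ^ 2 * PowerSeries.derivative ℂ f)

theorem pd_smul (c : ℂ) (f : PowerSeries ℂ) : pd (c • f) = c • pd f := by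
  simp only [pd, Derivation.map_smul, mul_smul_comm, smul_neg]

theorem pd_iterate_smul (c : ℂ) (i : ℕ) (f : PowerSeries ℂ) : pd^[i] (c • f) = c • pd^[i] f := by
  induction i generalizing f with
  | zero => rfl
  | succ i ih => rw [Function.iterate_succ_apply, pd_smul, ih, Function.iterate_succ_apply]

/-- The left-hand side of the hierarchy on power series. -/
def seriesP34 (d : ℕ) (f : PowerSeries ℂ) : PowerSeries ℂ :=
  (2 ^ (2 * d + 1) * ((2 * d + 1)‼ : ℂ)) •
      pd (MvPolynomial.aeval (fun i => (1 / 2 : ℂ) • pd^[i] f) (m d)) +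
    PowerSeries.X * PowerSeries.derivative ℂ f - (2 : ℂ) • f

theorem derivative_ofPowerSeries (f : PowerSeries ℂ) :
    LaurentSeries.derivative ℂ (HahnSeries.ofPowerSeries ℤ ℂ f) =
      HahnSeries.ofPowerSeries ℤ ℂ (PowerSeries.derivative ℂ f) := by
  ext n
  rw [LaurentSeries.derivative_apply, LaurentSeries.hasseDeriv_coeff, PowerSeries.coeff_coe,
    PowerSeries.coeff_coe, Nat.cast_one, Ring.choose_one_right]
  rcases lt_trichotomy n (-1) with h | rfl | h
  · rw [if_pos (by omega), if_pos (by omega), smul_zero]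
  · simp
  · obtain ⟨k, rfl⟩ := Int.eq_ofNat_of_zero_le (show 0 ≤ n by omega)
    rw [if_neg (by omega), if_neg (by omega), PowerSeries.coeff_derivative]
    have h1 : ((k : ℤ) + 1).natAbs = k + 1 := by omega
    have h2 : (k : ℤ).natAbs = k := by omega
    rw [h1, h2, zsmul_eq_mul]
    push_cast
    ring

theorem dX_ofPowerSeries (f : PowerSeries ℂ) :
    dX (HahnSeries.ofPowerSeries ℤ ℂ f) = HahnSeries.ofPowerSeries ℤ ℂ (pd f) := by
  rw [dX, derivative_ofPowerSeries, pd, map_neg, map_mul, HahnSeries.ofPowerSeries_X_pow]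
  rfl

theorem smul_ofPowerSeries (c : ℂ) (f : PowerSeries ℂ) :
    HahnSeries.ofPowerSeries ℤ ℂ (c • f) = c • HahnSeries.ofPowerSeries ℤ ℂ f := by
  rw [PowerSeries.smul_eq_C_mul, map_mul, HahnSeries.ofPowerSeries_C, HahnSeries.C_mul_eq_smul]

theorem dX_iterate_ofPowerSeries (i : ℕ) (f : PowerSeries ℂ) :
    dX^[i] (HahnSeries.ofPowerSeries ℤ ℂ f) = HahnSeries.ofPowerSeries ℤ ℂ (pd^[i] f) := by
  induction i generalizing f with
  | zero => rfl
  | succ i ih => rw [Function.iterate_succ_apply, dX_ofPowerSeries, ih, Function.iterate_succ_apply]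

theorem ringHom_aeval {B B' : Type*} [CommRing B] [CommRing B'] [Algebra ℚ B] [Algebra ℚ B']
    (F : B →+* B') (g : ℕ → B) (p : DiffPoly) :
    F (MvPolynomial.aeval g p) = MvPolynomial.aeval (fun i => F (g i)) p := by
  induction p using MvPolynomial.induction_on with
  | C c => simp only [MvPolynomial.aeval_C]; exact F.map_rat_algebraMap c
  | add p q hp hq => simp only [map_add, hp, hq]
  | mul_X p i hp => simp only [map_mul, hp, MvPolynomial.aeval_X]

/-- In `w = X⁻¹` one has `X d/dX = -w d/dw`, which explains the changed sign in `seriesP34`. -/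
theorem P34_ofPowerSeries (d : ℕ) (f : PowerSeries ℂ) :
    P34 d (HahnSeries.ofPowerSeries ℤ ℂ f) = HahnSeries.ofPowerSeries ℤ ℂ (seriesP34 d f) := by
  have h1 : (fun i => (1 / 2 : ℂ) • dX^[i] (HahnSeries.ofPowerSeries ℤ ℂ f)) =
      fun i => HahnSeries.ofPowerSeries ℤ ℂ ((1 / 2 : ℂ) • pd^[i] f) := by
    funext i
    rw [dX_iterate_ofPowerSeries, smul_ofPowerSeries]
  have h2 : varX * dX (HahnSeries.ofPowerSeries ℤ ℂ f) =
      -HahnSeries.ofPowerSeries ℤ ℂ (PowerSeries.X * PowerSeries.derivative ℂ f) := by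
    have hX : varX * HahnSeries.ofPowerSeries ℤ ℂ PowerSeries.X = 1 := by
      rw [varX, HahnSeries.ofPowerSeries_X, HahnSeries.single_mul_single]
      norm_num
    rw [dX_ofPowerSeries, pd, map_neg, sq, mul_assoc, map_mul]
    generalize HahnSeries.ofPowerSeries ℤ ℂ (PowerSeries.X * PowerSeries.derivative ℂ f) = g
    have e : ∀ v x g : InvSeries, v * x = 1 → v * -(x * g) = -g := fun v x g h => by
      linear_combination (-g) * h
    exact e _ _ g hX
  rw [P34, h1, ← ringHom_aeval, dX_ofPowerSeries, h2, seriesP34, map_sub, map_add,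
    smul_ofPowerSeries, smul_ofPowerSeries, sub_neg_eq_add]

/-- The power series of the ansatz. -/
def ansatzSeries (d : ℕ) (y : ℕ → ℂ) : PowerSeries ℂ :=
  PowerSeries.mk fun k => if 2 ≤ k ∧ (2 * d + 1) ∣ k - 2 then y ((k - 2) / (2 * d + 1)) else 0

theorem isFormalSolution_iff (d : ℕ) (y : ℕ → ℂ) :
    IsFormalSolution d y ↔ y 0 = 1 / 4 ∧ seriesP34 d (ansatzSeries d y) = 0 := by
  have h : ansatz d y = HahnSeries.ofPowerSeries ℤ ℂ (ansatzSeries d y) := rfl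
  rw [IsFormalSolution, h, P34_ofPowerSeries]
  refine and_congr_right fun _ => ?_
  rw [← map_zero (HahnSeries.ofPowerSeries ℤ ℂ)]
  exact HahnSeries.ofPowerSeries_injective.eq_iff

/-! ### Uniqueness -/

theorem X_pow_dvd_pd {K : ℕ} {f : PowerSeries ℂ} (h : PowerSeries.X ^ K ∣ f) :
    PowerSeries.X ^ (K + 1) ∣ pd f := by
  obtain ⟨q, rfl⟩ := h
  rw [pd, dvd_neg, Derivation.leibniz, smul_eq_mul, smul_eq_mul, mul_add]
  refine dvd_add ⟨PowerSeries.X * PowerSeries.derivative ℂ q, by ring⟩ ?_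
  cases K with
  | zero => simp
  | succ K =>
    rw [PowerSeries.derivative_pow, PowerSeries.derivative_X, Nat.add_sub_cancel]
    exact ⟨q * ((K + 1 : ℕ) : PowerSeries ℂ), by ring⟩

theorem X_pow_dvd_pd_iterate {K : ℕ} (i : ℕ) {f : PowerSeries ℂ} (h : PowerSeries.X ^ K ∣ f) :
    PowerSeries.X ^ K ∣ pd^[i] f := by
  induction i with
  | zero => exact h
  | succ i ih =>
    rw [Function.iterate_succ_apply']
    exact (pow_dvd_pow _ (Nat.le_succ K)).trans (X_pow_dvd_pd ih)

theorem pd_sub (f g : PowerSeries ℂ) : pd (f - g) = pd f - pd g := by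
  simp only [pd, map_sub]; ring

theorem pd_iterate_sub (i : ℕ) (f g : PowerSeries ℂ) : pd^[i] (f - g) = pd^[i] f - pd^[i] g := by
  induction i generalizing f g with
  | zero => rfl
  | succ i ih => simp only [Function.iterate_succ_apply, pd_sub, ih]

theorem dvd_aeval_sub_aeval {B : Type*} [CommRing B] [Algebra ℚ B] {x : B} {g g' : ℕ → B}
    (h : ∀ i, x ∣ g i - g' i) (p : DiffPoly) :
    x ∣ MvPolynomial.aeval g p - MvPolynomial.aeval g' p := by
  induction p using MvPolynomial.induction_on with
  | C c => simp
  | add p q hp hq =>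
    rw [map_add, map_add, add_sub_add_comm]
    exact dvd_add hp hq
  | mul_X p i hp =>
    simp only [map_mul, MvPolynomial.aeval_X]
    have e : ∀ a b c e : B, a * b - c * e = (a - c) * b + c * (b - e) := fun a b c e => by ring
    rw [e]
    exact dvd_add (hp.mul_right _) ((h i).mul_left _)

theorem coeff_X_mul_derivative (f : PowerSeries ℂ) (k : ℕ) :
    PowerSeries.coeff k (PowerSeries.X * PowerSeries.derivative ℂ f) =
      k * PowerSeries.coeff k f := by
  cases k with
  | zero => simp
  | succ k =>
    rw [PowerSeries.coeff_succ_X_mul, PowerSeries.coeff_derivative]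
    push_cast; ring

/-- If two solutions agree below index `n`, they agree modulo `w^K` with `K = (2d+1) n + 2`. Since
`d/dX` raises the order, the nonlinear terms agree through `w^K`. The rest, `w d/dw - 2`, multiplies
that coefficient by `K - 2 ≠ 0`. -/
theorem isFormalSolution_unique (d : ℕ) {y y' : ℕ → ℂ} (hy : IsFormalSolution d y)
    (hy' : IsFormalSolution d y') : y = y' := by
  rw [isFormalSolution_iff] at hy hy'
  funext n
  induction n using Nat.strong_induction_on with
  | _ n ih =>
    rcases Nat.eq_zero_or_pos n with rfl | hn
    · rw [hy.1, hy'.1]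
    set K := (2 * d + 1) * n + 2 with hK
    have hc : ∀ z : ℕ → ℂ, PowerSeries.coeff K (ansatzSeries d z) = z n := by
      intro z
      rw [ansatzSeries, PowerSeries.coeff_mk, if_pos ⟨by omega, ⟨n, by omega⟩⟩,
        show K - 2 = (2 * d + 1) * n by omega, Nat.mul_div_cancel_left _ (by omega)]
    have hdvd : PowerSeries.X ^ K ∣ ansatzSeries d y - ansatzSeries d y' := by
      rw [PowerSeries.X_pow_dvd_iff]
      intro k hk
      rw [map_sub, sub_eq_zero, ansatzSeries, ansatzSeries, PowerSeries.coeff_mk,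
        PowerSeries.coeff_mk]
      split_ifs with h
      · refine ih _ ?_
        rw [Nat.div_lt_iff_lt_mul (by omega), mul_comm]
        omega
      · rfl
    have h1 : PowerSeries.X ^ K ∣
        MvPolynomial.aeval (fun i => (1 / 2 : ℂ) • pd^[i] (ansatzSeries d y)) (m d) -
        MvPolynomial.aeval (fun i => (1 / 2 : ℂ) • pd^[i] (ansatzSeries d y')) (m d) := by
      refine dvd_aeval_sub_aeval (fun i => ?_) _
      rw [← smul_sub, ← pd_iterate_sub]
      rw [PowerSeries.smul_eq_C_mul]
      exact (X_pow_dvd_pd_iterate i hdvd).mul_left _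
    have h2 := PowerSeries.X_pow_dvd_iff.1 (X_pow_dvd_pd h1) K (Nat.lt_succ_self K)
    have h3 := congrArg (PowerSeries.coeff K) (hy.2.trans hy'.2.symm)
    rw [pd_sub, map_sub, sub_eq_zero] at h2
    simp only [seriesP34, map_sub, map_add, PowerSeries.coeff_smul, h2, coeff_X_mul_derivative, hc,
      smul_eq_mul] at h3
    have h4 : ((K : ℂ) - 2) * (y n - y' n) = 0 := by linear_combination h3
    have h5 : (K : ℂ) - 2 ≠ 0 := by
      rw [hK]
      push_cast
      rw [add_sub_cancel_right]
      have : ((2 * d + 1) * n : ℕ) ≠ 0 := by positivity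
      exact_mod_cast this
    exact sub_eq_zero.1 ((mul_eq_zero.1 h4).resolve_left h5)

/-! ### Weighted scaling of the variables -/

theorem hasWeight_monomial (s : ℕ →₀ ℕ) (c : ℚ) :
    HasWeight (MvPolynomial.monomial s c) ((∑ i ∈ s.support, (i + 2) * s i : ℕ) : ℚ) := by
  have key : ∀ i ∈ s.support, MvPolynomial.monomial (s - Finsupp.single i 1) (s i : ℚ) •
      ((i + 2 : ℚ) • (MvPolynomial.X i : DiffPoly)) =
      MvPolynomial.monomial s (((i + 2) * s i : ℕ) : ℚ) := by
    intro i hi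
    rw [smul_eq_mul, MvPolynomial.X, MvPolynomial.smul_monomial, MvPolynomial.monomial_mul,
      tsub_add_cancel_of_le (Finsupp.single_le_iff.2
        (Nat.one_le_iff_ne_zero.2 (Finsupp.mem_support_iff.1 hi)))]
    congr 1
    rw [smul_eq_mul]
    push_cast; ring
  rw [HasWeight, weightDeriv, MvPolynomial.mkDerivation_monomial, Finsupp.sum,
    Finset.sum_congr rfl key, ← map_sum, MvPolynomial.smul_monomial, MvPolynomial.smul_monomial,
    ← Nat.cast_sum, smul_eq_mul, smul_eq_mul, mul_comm]

/-- The weight derivation is diagonal on monomials, so `HasWeight` means that every monomial present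
has the given weight; this yields the scaling rule below. -/
theorem coeff_weightDeriv (s : ℕ →₀ ℕ) (p : DiffPoly) :
    MvPolynomial.coeff s (weightDeriv p) =
      ((∑ i ∈ s.support, (i + 2) * s i : ℕ) : ℚ) * MvPolynomial.coeff s p := by
  induction p using MvPolynomial.monomial_add_induction_on with
  | C c =>
    rw [show weightDeriv (MvPolynomial.C c) = 0 by
      rw [← MvPolynomial.algebraMap_eq, Derivation.map_algebraMap], MvPolynomial.coeff_C]
    split_ifs with h
    · subst h; simp
    · simp
  | monomial_add t c p _ _ hp =>
    rw [map_add, MvPolynomial.coeff_add, MvPolynomial.coeff_add, hp, mul_add,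
      hasWeight_monomial t c, MvPolynomial.coeff_smul, MvPolynomial.coeff_monomial]
    split_ifs with h
    · rw [h, smul_eq_mul]
    · simp

theorem HasWeight.aeval_pow_mul {B : Type*} [CommRing B] [Algebra ℚ B] {p : DiffPoly} {W : ℕ}
    (hp : HasWeight p W) (r : B) (g : ℕ → B) :
    MvPolynomial.aeval (fun i => r ^ (i + 2) * g i) p = r ^ W * MvPolynomial.aeval g p := by
  rw [MvPolynomial.aeval_def, MvPolynomial.aeval_def, MvPolynomial.eval₂_eq,
    MvPolynomial.eval₂_eq, Finset.mul_sum]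
  refine Finset.sum_congr rfl fun s hs => ?_
  have h := coeff_weightDeriv s p
  rw [hp, MvPolynomial.coeff_smul, smul_eq_mul] at h
  have hW := Nat.cast_injective (mul_right_cancel₀ (MvPolynomial.mem_support_iff.1 hs) h)
  simp only [mul_pow, Finset.prod_mul_distrib, ← pow_mul, Finset.prod_pow_eq_pow_sum, ← hW]
  ring

/-! ### The flow of the base solution -/

/-- The Taylor series of the flow `d` with time `4 ^ d / (2 * d + 1) * s`, at the base point. -/
def flowSeries (d : ℕ) (a : DiffPoly) : PowerSeries ℂ :=
  PowerSeries.mk fun n =>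
    ((4 : ℂ) ^ d / (2 * d + 1)) ^ n / (n ! : ℂ) * ((evalBase ((flow d)^[n] a) : ℚ) : ℂ)

theorem constantCoeff_flowSeries (d : ℕ) (a : DiffPoly) :
    PowerSeries.coeff 0 (flowSeries d a) = ((evalBase a : ℚ) : ℂ) := by
  simp [flowSeries, PowerSeries.coeff_mk]

theorem derivative_flowSeries (d : ℕ) (a : DiffPoly) :
    PowerSeries.derivative ℂ (flowSeries d a) =
      PowerSeries.C ((4 : ℂ) ^ d / (2 * d + 1)) * flowSeries d (flow d a) := by
  ext n
  rw [PowerSeries.coeff_derivative, PowerSeries.coeff_C_mul, flowSeries, flowSeries,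
    PowerSeries.coeff_mk, PowerSeries.coeff_mk, Function.iterate_succ_apply, Nat.factorial_succ]
  generalize (4 : ℂ) ^ d / (2 * d + 1) = κ
  have h1 : (n ! : ℂ) ≠ 0 := Nat.cast_ne_zero.2 (Nat.factorial_ne_zero n)
  have h2 : (n + 1 : ℂ) ≠ 0 := Nat.cast_add_one_ne_zero n
  push_cast
  field_simp
  ring

theorem flowSeries_add (d : ℕ) (a b : DiffPoly) :
    flowSeries d (a + b) = flowSeries d a + flowSeries d b := by
  ext n
  rw [map_add]
  simp only [flowSeries, PowerSeries.coeff_mk, iterate_map_add, map_add, Rat.cast_add, mul_add]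

theorem flowSeries_one (d : ℕ) : flowSeries d 1 = 1 := by
  ext n
  rw [flowSeries, PowerSeries.coeff_mk, PowerSeries.coeff_one]
  cases n with
  | zero => simp
  | succ n => simp [Function.iterate_succ_apply, iterate_map_zero]

/-- The exponential of a derivation is multiplicative: both sides have the same constant term, and
by the Leibniz rule their derivatives agree inductively. -/
theorem flowSeries_mul (d : ℕ) (a b : DiffPoly) :
    flowSeries d (a * b) = flowSeries d a * flowSeries d b := by
  ext n
  induction n generalizing a b with
  | zero =>
    rw [PowerSeries.coeff_mul, Finset.HasAntidiagonal.antidiagonal_zero, Finset.sum_singleton]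
    simp only [constantCoeff_flowSeries, map_mul, Rat.cast_mul]
  | succ n ih =>
    have h2 : (n + 1 : ℂ) ≠ 0 := Nat.cast_add_one_ne_zero n
    refine mul_right_cancel₀ h2 ?_
    rw [← PowerSeries.coeff_derivative, ← PowerSeries.coeff_derivative, derivative_flowSeries,
      Derivation.leibniz, Derivation.leibniz, flowSeries_add, derivative_flowSeries,
      derivative_flowSeries, PowerSeries.coeff_C_mul, map_add, smul_eq_mul, smul_eq_mul, ih, ih,
      smul_eq_mul, smul_eq_mul, map_add, mul_left_comm, mul_left_comm (flowSeries d b),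
      PowerSeries.coeff_C_mul, PowerSeries.coeff_C_mul, mul_add]

theorem flowSeries_zero (d : ℕ) : flowSeries d 0 = 0 := by
  ext n
  simp [flowSeries, iterate_map_zero]

theorem HasWeight.flow_iterate {a : DiffPoly} {w : ℚ} (d n : ℕ) (ha : HasWeight a w) :
    HasWeight ((PainleveXXXIV.flow d)^[n] a) (w + (2 * d + 1) * n) := by
  induction n with
  | zero => simpa using ha
  | succ n ih =>
    rw [Function.iterate_succ_apply']
    convert ih.flow d using 1
    push_cast; ring

theorem iterate_flow_del (d n : ℕ) (a : DiffPoly) :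
    (flow d)^[n] (del a) = del ((flow d)^[n] a) := by
  induction n generalizing a with
  | zero => rfl
  | succ n ih => rw [Function.iterate_succ_apply, flow_del, ih, Function.iterate_succ_apply]

/-- Each application of `flow d` adds `2d + 1` to the weight, so the `x`-derivative at the base
point becomes an Euler operator in the time. -/
theorem flowSeries_del (d : ℕ) {a : DiffPoly} {W : ℕ} (ha : HasWeight a W) :
    flowSeries d (del a) = (W : ℂ) • flowSeries d a +
      (2 * d + 1 : ℂ) • (PowerSeries.X * PowerSeries.derivative ℂ (flowSeries d a)) := by
  ext n
  rw [map_add, PowerSeries.coeff_smul, PowerSeries.coeff_smul, coeff_X_mul_derivative, flowSeries,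
    flowSeries, PowerSeries.coeff_mk, PowerSeries.coeff_mk, iterate_flow_del,
    evalBase_del_of_hasWeight (ha.flow_iterate d n), smul_eq_mul, smul_eq_mul]
  push_cast
  ring

theorem X_mul_derivative_expand (p : ℕ) (hp : p ≠ 0) (f : PowerSeries ℂ) :
    PowerSeries.X * PowerSeries.derivative ℂ (PowerSeries.expand p hp f) =
      (p : ℂ) • PowerSeries.expand p hp (PowerSeries.X * PowerSeries.derivative ℂ f) := by
  ext k
  rw [coeff_X_mul_derivative, PowerSeries.coeff_smul]
  by_cases h : p ∣ k
  · obtain ⟨j, rfl⟩ := h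
    rw [PowerSeries.coeff_expand_mul, PowerSeries.coeff_expand_mul, coeff_X_mul_derivative,
      smul_eq_mul]
    push_cast; ring
  · rw [PowerSeries.coeff_expand_of_not_dvd _ _ _ h, PowerSeries.coeff_expand_of_not_dvd _ _ _ h,
      mul_zero, smul_zero]

/-- The ring homomorphism `a ↦ flowSeries d a (w ^ (2 * d + 1))`. -/
def flowHom (d : ℕ) : DiffPoly →+* PowerSeries ℂ where
  toFun a := PowerSeries.expand (2 * d + 1) (Nat.succ_ne_zero _) (flowSeries d a)
  map_one' := by rw [flowSeries_one, map_one]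
  map_mul' a b := by rw [flowSeries_mul, map_mul]
  map_zero' := by rw [flowSeries_zero, map_zero]
  map_add' a b := by rw [flowSeries_add, map_add]

theorem flowHom_apply (d : ℕ) (a : DiffPoly) : flowHom d a =
    PowerSeries.expand (2 * d + 1) (Nat.succ_ne_zero _) (flowSeries d a) := rfl

theorem flowHom_del (d : ℕ) {a : DiffPoly} {W : ℕ} (ha : HasWeight a W) :
    flowHom d (del a) = (W : ℂ) • flowHom d a +
      PowerSeries.X * PowerSeries.derivative ℂ (flowHom d a) := by
  rw [flowHom_apply, flowSeries_del d ha, map_add, flowHom_apply, X_mul_derivative_expand, map_smul,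
    map_smul]
  push_cast
  rfl

theorem X_mul_derivative_flowHom (d : ℕ) (a : DiffPoly) :
    PowerSeries.X * PowerSeries.derivative ℂ (flowHom d a) =
      (4 : ℂ) ^ d • (PowerSeries.X ^ (2 * d + 1) * flowHom d (flow d a)) := by
  have h : (2 * d + 1 : ℂ) ≠ 0 := by exact_mod_cast Nat.succ_ne_zero (2 * d)
  rw [flowHom_apply, X_mul_derivative_expand, derivative_flowSeries, mul_left_comm,
    ← PowerSeries.smul_eq_C_mul, map_smul, smul_smul, map_mul, PowerSeries.expand_X, flowHom_apply]
  push_cast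
  rw [mul_div_cancel₀ _ h]

/-- Self-similarity: attaching `(-w)^W = (1 - x)^(-W)`, with `X = x - 1`, to the image of a
polynomial of weight `W` intertwines `∂` with `d/dX`. -/
theorem pd_neg_X_pow_mul_flowHom (d : ℕ) {a : DiffPoly} {W : ℕ} (ha : HasWeight a W) :
    pd ((-PowerSeries.X) ^ W * flowHom d a) = (-PowerSeries.X) ^ (W + 1) * flowHom d (del a) := by
  rw [flowHom_del d ha, pd, Derivation.leibniz, smul_eq_mul, smul_eq_mul, Derivation.leibniz_pow,
    map_neg, PowerSeries.derivative_X, PowerSeries.smul_eq_C_mul, map_natCast]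
  cases W with
  | zero => simp; ring
  | succ W =>
    rw [Nat.add_sub_cancel, nsmul_eq_mul, smul_eq_mul]
    ring

/-! ### Existence -/

/-- The coefficients of the formal solution. -/
def sol (d n : ℕ) : ℂ := 2 * PowerSeries.coeff n (flowSeries d (MvPolynomial.X 0))

theorem ansatzSeries_sol (d : ℕ) :
    ansatzSeries d (sol d) =
      (2 : ℂ) • ((-PowerSeries.X) ^ 2 * flowHom d (MvPolynomial.X 0)) := by
  ext k
  rw [neg_sq, PowerSeries.coeff_smul, PowerSeries.coeff_X_pow_mul', flowHom_apply,
    PowerSeries.coeff_expand, ansatzSeries, PowerSeries.coeff_mk, ite_and]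
  split_ifs <;> simp [sol]

theorem half_smul_pd_iterate_ansatzSeries_sol (d i : ℕ) :
    (1 / 2 : ℂ) • pd^[i] (ansatzSeries d (sol d)) =
      (-PowerSeries.X) ^ (i + 2) * flowHom d (MvPolynomial.X i) := by
  rw [ansatzSeries_sol, pd_iterate_smul, smul_smul]
  norm_num
  induction i with
  | zero => simp
  | succ i ih =>
    have h : HasWeight (MvPolynomial.X i) ((i + 2 : ℕ) : ℚ) := by exact_mod_cast hasWeight_X i
    rw [Function.iterate_succ_apply', ih, pd_neg_X_pow_mul_flowHom d h, del_X]

theorem m_eq (d : ℕ) : m d = (1 / ((2 * d + 1)‼ : ℚ)) • beta (d + 1) := rfl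

/-- The double factorial turns `m_d` into `β_{d+1}`, and `∂ β_{d+1}` is the `d`-th flow of `u₀`. -/
theorem pd_aeval_m_sol (d : ℕ) :
    ((2 * d + 1)‼ : ℂ) • pd (MvPolynomial.aeval
        (fun i => (1 / 2 : ℂ) • pd^[i] (ansatzSeries d (sol d))) (m d)) =
      (-PowerSeries.X) ^ (2 * d + 3) * flowHom d (flow d (MvPolynomial.X 0)) := by
  have hw : HasWeight (beta (d + 1)) ((2 * d + 2 : ℕ) : ℚ) := by
    convert hasWeight_beta (d + 1) using 1
    push_cast; ring
  have h : ((2 * d + 1)‼ : ℂ) ≠ 0 := Nat.cast_ne_zero.2 (Nat.doubleFactorial_pos _).ne'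
  have e : MvPolynomial.aeval (fun i => flowHom d (MvPolynomial.X i)) (beta (d + 1)) =
      flowHom d (beta (d + 1)) := by
    rw [← ringHom_aeval, MvPolynomial.aeval_X_left_apply]
  have hc : ∀ (c : ℚ) (f : PowerSeries ℂ), c • f = (c : ℂ) • f := fun c f => by
    ext n
    rw [PowerSeries.coeff_smul n f (c : ℂ), smul_eq_mul, ← Rat.smul_def]
    rfl
  simp only [half_smul_pd_iterate_ansatzSeries_sol]
  rw [m_eq, map_smul, hw.aeval_pow_mul, e, hc, pd_smul, smul_smul,
    pd_neg_X_pow_mul_flowHom d hw, flow_X_zero]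
  push_cast
  rw [mul_one_div_cancel h, one_smul]

/-- With `Y = 2 w² f`, the terms `w Y_w - 2 Y` reduce to `2 w² (w f_w)`. By
`X_mul_derivative_flowHom` this cancels the flow term; the time scale `4^d / (2d + 1)` and `2^(2d+1)
= 2 * 4^d` make the constants match. -/
theorem isFormalSolution_sol (d : ℕ) : IsFormalSolution d (sol d) := by
  rw [isFormalSolution_iff]
  constructor
  · rw [sol, constantCoeff_flowSeries, evalBase, MvPolynomial.aeval_X]
    norm_num
  · rw [seriesP34, mul_smul, pd_aeval_m_sol, ansatzSeries_sol]
    have h := X_mul_derivative_flowHom d (MvPolynomial.X 0)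
    rw [PowerSeries.smul_eq_C_mul] at h
    rw [Derivation.map_smul, PowerSeries.smul_eq_C_mul, PowerSeries.smul_eq_C_mul,
      PowerSeries.smul_eq_C_mul, PowerSeries.smul_eq_C_mul, Derivation.leibniz, neg_sq, smul_eq_mul, smul_eq_mul,
      PowerSeries.derivative_pow, PowerSeries.derivative_X]
    have hp : (PowerSeries.C ((2 : ℂ) ^ (2 * d + 1)) : PowerSeries ℂ) =
        2 * PowerSeries.C ((4 : ℂ) ^ d) := by
      rw [← map_ofNat (PowerSeries.C (R := ℂ)) 2, ← map_mul]
      congr 1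
      rw [pow_succ, pow_mul]; norm_num [mul_comm]
    have hn : (-PowerSeries.X : PowerSeries ℂ) ^ (2 * d + 3) = -PowerSeries.X ^ (2 * d + 3) :=
      Odd.neg_pow ⟨d + 1, by ring⟩ _
    rw [hp, hn, map_ofNat]
    push_cast
    linear_combination (2 * PowerSeries.X ^ 2) * h

/-! ### Asymptotics -/

theorem flows_replicate (d n : ℕ) (a : DiffPoly) :
    flows (Multiset.replicate n d) a = (flow d)^[n] a := by
  induction n with
  | zero => rfl
  | succ n ih =>
    rw [Multiset.replicate_succ, flows, iterDeriv_cons, Function.iterate_succ_apply', ← ih]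

theorem mwt_replicate (d n : ℕ) : mwt (Multiset.replicate n d) = (2 * d + 1) * n := by
  rw [mwt_eq, Multiset.sum_replicate, Multiset.card_replicate, smul_eq_mul]; ring

/-- The factor `(N + 1) (N + 2)` between `psi` and the flow of `u₀` completes `N!` from `cnum` to
`(N + 2)!`, where `N + 1 = (2d + 1) n`. The case `n = 0` is excluded because `psi 0` is a default
value. -/
theorem sol_eq (d : ℕ) {n : ℕ} (hn : n ≠ 0) :
    sol d n = ((cnum (Multiset.replicate n d) / 2 : ℝ) : ℂ) *
      ((((2 * d + 1) * n + 1)! : ℂ) / ((2 * (d : ℂ) + 1) ^ n * (n ! : ℂ))) := by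
  obtain ⟨N, hN⟩ : ∃ N, (2 * d + 1) * n = N + 1 :=
    Nat.exists_eq_succ_of_ne_zero (mul_ne_zero (Nat.succ_ne_zero _) hn)
  have h1 : evalBase ((flow d)^[n] (MvPolynomial.X 0)) =
      (N + 1) * (N + 2) * psi (Multiset.replicate n d) := by
    rw [psi, flows_replicate, mwt_replicate, hN]
    have : (N + 1 : ℚ) ≠ 0 := Nat.cast_add_one_ne_zero N
    have : (N + 1 + 1 : ℚ) ≠ 0 := by positivity
    push_cast
    field_simp
    ring
  have h3 : (N ! : ℂ) ≠ 0 := Nat.cast_ne_zero.2 (Nat.factorial_ne_zero N)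
  have h4 : (n ! : ℂ) ≠ 0 := Nat.cast_ne_zero.2 (Nat.factorial_ne_zero n)
  have h5 : (2 * d + 1 : ℂ) ≠ 0 := by exact_mod_cast Nat.succ_ne_zero (2 * d)
  rw [sol, flowSeries, PowerSeries.coeff_mk, h1, cnum, mwt_replicate, hN, Multiset.sum_replicate,
    Nat.add_sub_cancel, Nat.factorial_succ, Nat.factorial_succ, smul_eq_mul, div_pow, pow_succ,
    mul_comm n d, pow_mul]
  push_cast
  field_simp
  ring

theorem isEquivalent_sol {d : ℕ} (hd : 1 ≤ d) :
    sol d ~[atTop] fun n : ℕ => (1 / (Real.pi : ℂ)) *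
      ((((2 * d + 1) * n + 1)! : ℂ) / ((2 * (d : ℂ) + 1) ^ n * (n ! : ℂ))) := by
  have hpi : (Real.pi : ℂ) ≠ 0 := Complex.ofReal_ne_zero.2 Real.pi_ne_zero
  refine isEquivalent_of_tendsto_one ?_
  have h := ((tendsto_cnum_replicate hd).mul_const (Real.pi / 2)).ofReal
  rw [show 2 / Real.pi * (Real.pi / 2) = 1 by field_simp] at h
  refine Tendsto.congr' ?_ (by simpa using h)
  filter_upwards [eventually_ne_atTop 0] with n hn
  have h3 : (((2 * d + 1) * n + 1)! : ℂ) ≠ 0 := Nat.cast_ne_zero.2 (Nat.factorial_ne_zero _)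
  have h4 : (n ! : ℂ) ≠ 0 := Nat.cast_ne_zero.2 (Nat.factorial_ne_zero n)
  have h5 : (2 * d + 1 : ℂ) ≠ 0 := by exact_mod_cast Nat.succ_ne_zero (2 * d)
  rw [Pi.div_apply, sol_eq d hn]
  push_cast
  field_simp

end PainleveXXXIV

end

theorem theorem9p3 (d : ℕ) (hd : 1 ≤ d) :
    (∃! y : ℕ → ℂ, PainleveXXXIV.IsFormalSolution d y) ∧
      ∀ y : ℕ → ℂ, PainleveXXXIV.IsFormalSolution d y →
        y ~[atTop] fun n : ℕ =>
          (1 / (Real.pi : ℂ)) *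
            ((((2 * d + 1) * n + 1)! : ℂ) / ((2 * (d : ℂ) + 1) ^ n * (n ! : ℂ))) := by
  have hs := PainleveXXXIV.isFormalSolution_sol d
  refine ⟨⟨_, hs, fun y hy => PainleveXXXIV.isFormalSolution_unique d hy hs⟩, fun y hy => ?_⟩
  rw [PainleveXXXIV.isFormalSolution_unique d hy hs]
  exact PainleveXXXIV.isEquivalent_sol hd
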